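/- Let $r\in\mathbb{R}\setminus\{0\}$ and, for $n\ge 1$, let $\lambda_r(n)=\sum_{ab=n}(a/b)^{ir}$ (sum over ordered pairs of positive integers) be the Hecke eigenvalues of the Eisenstein series $E_r=E(z,\tfrac12+ir)$ for $\mathrm{SL}_2(\mathbb{Z})$. Write $e(x)=e^{2\pi i x}$, and for $x>0$ put $$J_r^{+}(x)=\frac{-\pi}{\cosh(\pi r)}\bigl(Y_{2ir}(x)+Y_{-2ir}(x)\bigr),\qquad J_r^{-}(x)=4\cosh(\pi r)\,K_{2ir}(x),$$ where $Y_\nu$ and $K_\nu$ are the usual Bessel function and modified Bessel function of the second kind. Let $a$ and $c$ be coprime positive integers, let $\bar a$ be an integer with $a\bar a\equiv 1\pmod c$, and let $F:(0,\infty)\to\mathbb{C}$ be a smooth function of compact support. Then $$c\sum_{n=1}^\infty \lambda_r(n)\,e\Bigl(n\frac ac\Bigr)F(n)=\sum_{n=1}^\infty\lambda_r(n)\sum_{\pm}e\Bigl(\mp n\frac{\bar a}{c}\Bigr)\int_0^\infty F(x)\,J_r^{\pm}\Bigl(\frac{4\pi\sqrt{nx}}{c}\Bigr)dx+\sum_{\pm}\zeta(1\pm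 2ir)\int_0^\infty\Bigl(\frac{x}{c^2}\Bigr)^{\pm ir}F(x)\,dx,$$ where the series over $n$ on the right-hand side converges absolutely, also for each of the two signs separately. -/

import Mathlib

open scoped ContDiff Nat

noncomputable section

namespace Voronoi

/-- The additive character `e(x) = exp(2πix)`. -/
def e (x : ℝ) : ℂ :=
  Complex.exp (2 * Real.pi * Complex.I * x)

/-- The Hecke eigenvalue `λ_g(n) = ∑_{ab = n} (a/b)^{ir}` of the Eisenstein series
`g = E_r = E(z, 1/2 + ir)`; the sum is over the ordered pairs of positive integers with
product `n`. -/
def heckeEigenvalue (r : ℝ) (n : ℕ) : ℂ :=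
  ∑ p ∈ n.divisorsAntidiagonal, (((p.1 : ℝ) / (p.2 : ℝ) : ℝ) : ℂ) ^ (Complex.I * r)

/-- The Bessel function of the first kind
`J_ν(x) = ∑_{m ≥ 0} (-1)^m / (m! Γ(ν + m + 1)) (x/2)^{ν + 2m}`, for `x > 0` and complex order `ν`.
(`Complex.Gamma` is `0` at its poles, so `1/Γ` vanishes there, as it should.) -/
def besselJ (ν : ℂ) (x : ℝ) : ℂ :=
  ∑' m : ℕ, (-1) ^ m / ((m ! : ℂ) * Complex.Gamma (ν + m + 1)) *
    ((x / 2 : ℝ) : ℂ) ^ (ν + 2 * (m : ℂ))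

/-- The modified Bessel function of the first kind
`I_ν(x) = ∑_{m ≥ 0} 1 / (m! Γ(ν + m + 1)) (x/2)^{ν + 2m}`, for `x > 0` and complex order `ν`. -/
def besselI (ν : ℂ) (x : ℝ) : ℂ :=
  ∑' m : ℕ, 1 / ((m ! : ℂ) * Complex.Gamma (ν + m + 1)) *
    ((x / 2 : ℝ) : ℂ) ^ (ν + 2 * (m : ℂ))

/-- `(J_ν(x) cos(πν) - J_{-ν}(x)) / sin(πν)`, which is `Y_ν(x)` for non-integral `ν`. -/
def besselYQuot (ν : ℂ) (x : ℝ) : ℂ :=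
  (besselJ ν x * Complex.cos (Real.pi * ν) - besselJ (-ν) x) / Complex.sin (Real.pi * ν)

/-- `(π/2) (I_{-ν}(x) - I_ν(x)) / sin(πν)`, which is `K_ν(x)` for non-integral `ν`. -/
def besselKQuot (ν : ℂ) (x : ℝ) : ℂ :=
  Real.pi / 2 * ((besselI (-ν) x - besselI ν x) / Complex.sin (Real.pi * ν))

open Classical in
/-- The Bessel function of the second kind `Y_ν(x)`, for `x > 0`; at integral orders it is defined
by continuity in the order. -/
def besselY (ν : ℂ) (x : ℝ) : ℂ :=
  if ∃ k : ℤ, ν = k then Filter.limUnder (nhdsWithin ν {ν}ᶜ) (fun μ => besselYQuot μ x)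
  else besselYQuot ν x

open Classical in
/-- The modified Bessel function of the second kind `K_ν(x)`, for `x > 0`; at integral orders it is
defined by continuity in the order. -/
def besselK (ν : ℂ) (x : ℝ) : ℂ :=
  if ∃ k : ℤ, ν = k then Filter.limUnder (nhdsWithin ν {ν}ᶜ) (fun μ => besselKQuot μ x)
  else besselKQuot ν x

/-- The kernel `J_g^+(x) = -π / cosh(πr) (Y_{2ir}(x) + Y_{-2ir}(x))` for `g = E_r`. -/
def kernelPlus (r : ℝ) (x : ℝ) : ℂ :=
  -(Real.pi : ℂ) / (Real.cosh (Real.pi * r) : ℂ) *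
    (besselY (2 * Complex.I * r) x + besselY (-(2 * Complex.I * r)) x)

/-- The kernel `J_g^-(x) = 4 cosh(πr) K_{2ir}(x)` for `g = E_r`. -/
def kernelMinus (r : ℝ) (x : ℝ) : ℂ :=
  4 * (Real.cosh (Real.pi * r) : ℂ) * besselK (2 * Complex.I * r) x

/-- `∫_0^∞ F(x) J(4π √(nx) / c) dx` for a kernel `J` on `(0, ∞)`. -/
def hankelTransform (J : ℝ → ℂ) (F : ℝ → ℂ) (c n : ℕ) : ℂ :=
  ∫ x in Set.Ioi (0 : ℝ), F x * J (4 * Real.pi * Real.sqrt ((n : ℝ) * x) / (c : ℝ))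

/-- The term of index `n` in the dual sum with the sign `+`:
`λ_g(n) e(-n b / c) ∫_0^∞ F(x) J_g^+(4π √(nx) / c) dx`, where `b` is an inverse of `a` mod `c`. -/
def dualTermPlus (r : ℝ) (F : ℝ → ℂ) (c : ℕ) (b : ℤ) (n : ℕ) : ℂ :=
  heckeEigenvalue r n * e (-((n : ℝ) * (b : ℝ) / (c : ℝ))) * hankelTransform (kernelPlus r) F c n

/-- The term of index `n` in the dual sum with the sign `-`:
`λ_g(n) e(n b / c) ∫_0^∞ F(x) J_g^-(4π √(nx) / c) dx`, where `b` is an inverse of `a` mod `c`. -/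
def dualTermMinus (r : ℝ) (F : ℝ → ℂ) (c : ℕ) (b : ℤ) (n : ℕ) : ℂ :=
  heckeEigenvalue r n * e ((n : ℝ) * (b : ℝ) / (c : ℝ)) * hankelTransform (kernelMinus r) F c n

/-- The polar term `ζ(1 + 2it) ∫_0^∞ (x / c²)^{it} F(x) dx`; it is used for `t = r` and
`t = -r`. -/
def polarTerm (t : ℝ) (F : ℝ → ℂ) (c : ℕ) : ℂ :=
  riemannZeta (1 + 2 * Complex.I * t) *
    ∫ x in Set.Ioi (0 : ℝ), ((x / (c : ℝ) ^ 2 : ℝ) : ℂ) ^ (Complex.I * t) * F x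

end Voronoi

end

/-!
# Voronoi summation for the Eisenstein series `E(z, 1/2 + ir)`

The formula is two applications of Poisson summation to a sum over a lattice, followed by analytic
continuation; the modularity of `E_r` does not enter directly, only the unimodular change of basis
that exchanges `a / c` and `-b / c`, where `ab ≡ 1 mod c`.

Put `w = 2ir`, `G(x) = x^{ir} F(x)` and `Φ = 𝓕⁻ G`. Since `λ_r(n) = n^{ir} ∑_{j ∣ n} j^{-w}`, the
left hand side is `∑_{j, m} j^{-w} G(jm) e(jma/c)`. For `2 < re w` this sum, read as a function of
`w` with `G` fixed, comes from `∑ |n|^{-1-w} Φ(j / (cn))` over the lattice of the integral points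
`(j, n)` with `j ≡ an mod c`, which is absolutely convergent there (`summable_latticeTerm`).

* Poisson summation along the rows `n = const` gives the left hand side (`tsum_latticeTerm_row`).
* The same lattice is `n ≡ bj mod c` (`tsum_latticeTerm_comm`). The column `j = 0` gives a polar
  term with `ζ(1 + w)`. Along a column `j ≠ 0` Poisson summation produces the Fourier transform of
  `t ↦ |t|^{-1-w} Φ(1/t)` at `mj/c²`, the phases `e(±mjb/c)`, and, from the frequency `0`, the
  second polar term, which carries `ζ(w)` (`tsum_latticeTerm_column`); the functional equation
  turns it into `ζ(1 - w)` (`riemannZeta_mul_mellin_add`).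

At a frequency `ξ ≠ 0` that Fourier transform is a sum of two twisted Mellin transforms
`∫_0^∞ u^{w-1} Φ(±u) e(∓ξ/u) du`. Integration by parts against the oscillation `e(-ξ/u)` continues
them to `-2 < re w` with the bound `O(ξ^{-2})` (`exists_norm_twistedMellinExt_le`). So the dual
series converges absolutely and is holomorphic in `-1/2 < re w`, and the identity persists at
`w = 2ir` (`tsum_eq_dual`); the poles of `ζ(1 ± w)` at `w = 0` are avoided by staying in the half
plane `0 < r im w`.

It remains to see the Bessel kernels. For `0 < re w < 1` one inserts `Φ = 𝓕⁻ G`, with a damping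
factor `e^{-εu - ε/u}`, and exchanges the integrals. The inner integral
`∫_0^∞ u^{w-1} e^{-qu - p/u} du` is evaluated in `besselIntegral_eq` by comparing Wronskians at
`0`; adding the contributions of the two signs gives the combinations `J_{-w} - J_w` and
`I_{-w} - I_w` (`dualTransform_eq`), that is, the kernels `J_r^±`. Finally the pairs `(j, m)` are
grouped by their product.
-/

namespace Voronoi

open scoped SchwartzMap FourierTransform
open Complex Set Filter Topology MeasureTheory

/-! ### Entire Bessel functions -/

/-- The entire function `E_ν(z) = ∑ z^m / (m! Γ(ν + m + 1))`, for which
`I_ν(x) = (x/2)^ν E_ν(x²/4)` and `J_ν(x) = (x/2)^ν E_ν(-x²/4)`. -/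
noncomputable def besselEntire (ν z : ℂ) : ℂ :=
  ∑' m : ℕ, z ^ m / ((m ! : ℂ) * Complex.Gamma (ν + m + 1))

lemma norm_inv_Gamma_add_le {ν : ℂ} {δ : ℝ} (hδ : 0 < δ) (hδ1 : δ ≤ 1) (hν : -1 + δ ≤ ν.re)
    (m : ℕ) : ‖(Gamma (ν + m + 1))⁻¹‖ ≤ δ⁻¹ * ‖(Gamma (ν + 1))⁻¹‖ := by
  have h1 : 1 ≤ δ⁻¹ := (one_le_inv₀ hδ).2 hδ1
  -- Only the first step `Γ(ν + 2) = (ν + 1) Γ(ν + 1)` can decrease the modulus.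
  have h2 : ∀ k : ℕ, ‖(Gamma (ν + (k + 1 : ℕ) + 1))⁻¹‖ ≤ δ⁻¹ * ‖(Gamma (ν + 1))⁻¹‖ := by
    intro k
    induction k with
    | zero =>
      have hre : δ ≤ (ν + 1).re := by simp; linarith
      have h0 : ν + 1 ≠ 0 := fun h => by rw [h] at hre; simp at hre; linarith
      have : ν + ((0 + 1 : ℕ) : ℂ) + 1 = (ν + 1) + 1 := by push_cast; ring
      rw [this, Gamma_add_one _ h0, mul_inv, norm_mul]
      gcongr
      rw [norm_inv]
      exact inv_anti₀ hδ (hre.trans (re_le_norm _))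
    | succ k ih =>
      have hre : 1 ≤ (ν + (k + 1 : ℕ) + 1).re := by
        simp
        have : (0 : ℝ) ≤ k := k.cast_nonneg
        linarith
      have h0 : ν + (k + 1 : ℕ) + 1 ≠ 0 := fun h => by rw [h] at hre; simp at hre; linarith
      have : ν + ((k + 1 + 1 : ℕ) : ℂ) + 1 = (ν + (k + 1 : ℕ) + 1) + 1 := by push_cast; ring
      rw [this, Gamma_add_one _ h0, mul_inv, norm_mul]
      refine le_trans ?_ ih
      refine mul_le_of_le_one_left (norm_nonneg _) ?_
      rw [norm_inv]
      exact inv_le_one_of_one_le₀ (hre.trans (re_le_norm _))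
  rcases m with _ | k
  · simpa using le_mul_of_one_le_left (inv_nonneg.2 (norm_nonneg (Gamma (ν + 1)))) h1
  · exact h2 k

lemma norm_besselEntire_term_le {ν z : ℂ} {δ R : ℝ} (hδ : 0 < δ) (hδ1 : δ ≤ 1)
    (hν : -1 + δ ≤ ν.re) (hz : ‖z‖ ≤ R) (m : ℕ) :
    ‖z ^ m / ((m ! : ℂ) * Gamma (ν + m + 1))‖ ≤
      (δ⁻¹ * ‖(Gamma (ν + 1))⁻¹‖) * (R ^ m / m !) := by
  have : z ^ m / ((m ! : ℂ) * Gamma (ν + m + 1)) = (Gamma (ν + m + 1))⁻¹ * (z ^ m / m !) := by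
    rw [div_mul_eq_div_div, div_eq_inv_mul]
  rw [this, norm_mul, norm_div, norm_pow, norm_natCast]
  gcongr
  exact norm_inv_Gamma_add_le hδ hδ1 hν m

lemma summable_besselEntire {ν : ℂ} (hν : -1 < ν.re) (z : ℂ) :
    Summable fun m : ℕ => z ^ m / ((m ! : ℂ) * Gamma (ν + m + 1)) := by
  have hδ : 0 < min (ν.re + 1) 1 := lt_min (by linarith) one_pos
  refine Summable.of_norm_bounded ((Real.summable_pow_div_factorial ‖z‖).mul_left _)
    (norm_besselEntire_term_le hδ (min_le_right _ _) ?_ le_rfl)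
  linarith [min_le_left (ν.re + 1) 1]

lemma besselEntire_zero (ν : ℂ) : besselEntire ν 0 = (Gamma (ν + 1))⁻¹ := by
  rw [besselEntire, tsum_eq_single 0]
  · simp
  · intro m hm
    simp [hm]

/-- `z E_{ν+2}(z) + (ν+1) E_{ν+1}(z) = E_ν(z)`. -/
lemma besselEntire_recurrence {ν : ℂ} (hν : -1 < ν.re) (z : ℂ) :
    z * besselEntire (ν + 2) z + (ν + 1) * besselEntire (ν + 1) z = besselEntire ν z := by
  have hs2 : Summable fun m : ℕ => z ^ m / ((m ! : ℂ) * Gamma (ν + 2 + m + 1)) :=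
    summable_besselEntire (by simp; linarith) z
  have hs1 : Summable fun m : ℕ => z ^ m / ((m ! : ℂ) * Gamma (ν + 1 + m + 1)) :=
    summable_besselEntire (by simp; linarith) z
  have hs0 := summable_besselEntire hν z
  have hG : ∀ m : ℕ, Gamma (ν + m + 2) = (ν + m + 1) * Gamma (ν + m + 1) ∧
      ν + m + 1 ≠ 0 ∧ Gamma (ν + m + 1) ≠ 0 := by
    intro m
    have hm : (0 : ℝ) ≤ m := m.cast_nonneg
    have hre : 0 < (ν + m + 1).re := by simp; linarith
    have h0 : ν + m + 1 ≠ 0 := fun h => by rw [h] at hre; simp at hre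
    refine ⟨?_, h0, Gamma_ne_zero_of_re_pos hre⟩
    rw [← Gamma_add_one _ h0]; ring_nf
  unfold besselEntire
  rw [hs1.tsum_eq_zero_add, hs0.tsum_eq_zero_add, ← tsum_mul_left, mul_add, ← tsum_mul_left]
  rw [add_left_comm, ← (hs2.mul_left z).tsum_add (((summable_nat_add_iff 1).2 hs1).mul_left _)]
  congr 1
  · obtain ⟨h1, h2, h3⟩ := hG 0
    have e1 : ν + 1 + ((0 : ℕ) : ℂ) + 1 = ν + (0 : ℕ) + 2 := by push_cast; ring
    rw [e1, h1]
    simp only [Nat.cast_zero, add_zero] at h2 h3 ⊢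
    simp
    field_simp
  · refine tsum_congr fun m => ?_
    obtain ⟨h1, h2, h3⟩ := hG (m + 1)
    have e2 : ν + 2 + (m : ℂ) + 1 = ν + (m + 1 : ℕ) + 2 := by push_cast; ring
    have e1 : ν + 1 + ((m + 1 : ℕ) : ℂ) + 1 = ν + (m + 1 : ℕ) + 2 := by push_cast; ring
    rw [e1, e2, h1, Nat.factorial_succ]
    have hm1 : (m : ℂ) + 1 ≠ 0 := by exact_mod_cast Nat.succ_ne_zero m
    have hm2 : (m ! : ℂ) ≠ 0 := by exact_mod_cast Nat.factorial_ne_zero m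
    generalize hGG : Gamma (ν + (m + 1 : ℕ) + 1) = GG at *
    push_cast at h2 ⊢
    field_simp
    ring

lemma hasDerivAt_besselEntire {ν : ℂ} (hν : -1 < ν.re) (z : ℂ) :
    HasDerivAt (besselEntire ν) (besselEntire (ν + 1) z) z := by
  have hδ : 0 < min (ν.re + 1) 1 := lt_min (by linarith) one_pos
  set δ := min (ν.re + 1) 1
  have hδν : -1 + δ ≤ (ν + 1).re := by
    simp only [add_re, one_re]; linarith [min_le_left (ν.re + 1) 1]
  set C := δ⁻¹ * ‖(Gamma (ν + 1 + 1))⁻¹‖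
  have key : ∀ (n : ℕ) (y : ℂ), HasDerivAt (fun y : ℂ => y ^ n / ((n ! : ℂ) * Gamma (ν + n + 1)))
      ((n : ℂ) * y ^ (n - 1) / ((n ! : ℂ) * Gamma (ν + n + 1))) y := fun n y =>
    (hasDerivAt_pow n y).div_const _
  have shift : ∀ (m : ℕ) (y : ℂ),
      ((m + 1 : ℕ) : ℂ) * y ^ (m + 1 - 1) / (((m + 1)! : ℂ) * Gamma (ν + (m + 1 : ℕ) + 1)) =
        y ^ m / ((m ! : ℂ) * Gamma (ν + 1 + m + 1)) := by
    intro m y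
    have e1 : ν + ((m + 1 : ℕ) : ℂ) + 1 = ν + 1 + m + 1 := by push_cast; ring
    have hm1 : ((m + 1 : ℕ) : ℂ) ≠ 0 := by exact_mod_cast Nat.succ_ne_zero m
    rw [e1, Nat.factorial_succ, Nat.add_sub_cancel, Nat.cast_mul, mul_assoc,
      mul_div_mul_left _ _ hm1]
  have hu : Summable fun n : ℕ => if n = 0 then 0 else C * ((‖z‖ + 1) ^ (n - 1) / (n - 1)!) := by
    rw [← summable_nat_add_iff 1]
    simpa using! (Real.summable_pow_div_factorial (‖z‖ + 1)).mul_left C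
  have hder := hasDerivAt_tsum_of_isPreconnected hu (t := Metric.ball 0 (‖z‖ + 1))
    Metric.isOpen_ball (convex_ball _ _).isPreconnected (fun n y _ => key n y) (y₀ := 0)
    (fun n y hy => ?_) (by simp; positivity) (summable_besselEntire hν 0)
    (y := z) (by simp)
  · convert! hder using 1
    rw [besselEntire, ((summable_nat_add_iff 1).1 ?_ :
      Summable fun n : ℕ => (n : ℂ) * z ^ (n - 1) / ((n ! : ℂ) * Gamma (ν + n + 1))
      ).tsum_eq_zero_add]
    · simp only [shift]; simp
    · simp only [shift]
      exact summable_besselEntire (by simp; linarith) z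
  · rcases n with _ | m
    · simp
    · rw [shift]
      simp only [Nat.succ_ne_zero, if_false, Nat.add_sub_cancel]
      exact norm_besselEntire_term_le hδ (min_le_right _ _) hδν (mem_ball_zero_iff.1 hy).le m

/-- Joint continuity of `E_ν(z)` in `(ν, z)`. -/
lemma continuousOn_besselEntire :
    ContinuousOn (fun p : ℂ × ℂ => besselEntire p.1 p.2) {p | -1 < p.1.re} := by
  intro p₀ (hp₀ : -1 < p₀.1.re)
  set δ := min ((p₀.1.re + 1) / 2) 1 with hδdef
  have hδ : 0 < δ := lt_min (by linarith) one_pos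
  have hG : Continuous fun p : ℂ × ℂ => ‖(Gamma (p.1 + 1))⁻¹‖ :=
    (differentiable_one_div_Gamma.continuous.comp
      (by fun_prop : Continuous fun p : ℂ × ℂ => p.1 + 1)).norm
  set U : Set (ℂ × ℂ) := {p | -1 + δ < p.1.re ∧ ‖p.2‖ < ‖p₀.2‖ + 1 ∧
    ‖(Gamma (p.1 + 1))⁻¹‖ < ‖(Gamma (p₀.1 + 1))⁻¹‖ + 1}
  have hU : IsOpen U :=
    (isOpen_lt continuous_const (continuous_re.comp continuous_fst)).inter
      ((isOpen_lt continuous_snd.norm continuous_const).inter (isOpen_lt hG continuous_const))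
  have hmem : p₀ ∈ U := ⟨by linarith [min_le_left ((p₀.1.re + 1) / 2) 1], by simp, by simp⟩
  have hcont : ContinuousOn (fun p : ℂ × ℂ => besselEntire p.1 p.2) U := by
    refine continuousOn_tsum (u := fun m : ℕ =>
      (δ⁻¹ * (‖(Gamma (p₀.1 + 1))⁻¹‖ + 1)) * ((‖p₀.2‖ + 1) ^ m / m !)) (fun m => ?_)
      ((Real.summable_pow_div_factorial _).mul_left _) (fun m p hp => ?_)
    · have h1 : Continuous fun p : ℂ × ℂ => (Gamma (p.1 + m + 1))⁻¹ :=
        differentiable_one_div_Gamma.continuous.comp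
          (by fun_prop : Continuous fun p : ℂ × ℂ => p.1 + m + 1)
      have h2 : (fun p : ℂ × ℂ => p.2 ^ m / ((m ! : ℂ) * Gamma (p.1 + m + 1))) =
          fun p : ℂ × ℂ => p.2 ^ m / (m ! : ℂ) * (Gamma (p.1 + m + 1))⁻¹ := by
        ext p; rw [div_mul_eq_div_div, div_eq_mul_inv]
      rw [h2]
      exact (Continuous.mul (by fun_prop) h1).continuousOn
    · refine (norm_besselEntire_term_le hδ (min_le_right _ _) hp.1.le hp.2.1.le m).trans ?_
      gcongr
      exact hp.2.2.le
  exact (hcont.continuousAt (hU.mem_nhds hmem)).continuousWithinAt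

lemma continuous_besselEntire {ν : ℂ} (hν : -1 < ν.re) : Continuous (besselEntire ν) :=
  continuous_iff_continuousAt.2 fun z => (hasDerivAt_besselEntire hν z).continuousAt

lemma hasDerivAt_cpow_mul_besselEntire {s k : ℂ} (hs : 0 < s.re) {t : ℝ} (ht : 0 < t) :
    HasDerivAt (fun t : ℝ => (t : ℂ) ^ s * besselEntire s (k * t))
      ((t : ℂ) ^ (s - 1) * besselEntire (s - 1) (k * t)) t := by
  have hs0 : s ≠ 0 := fun h => by simp [h] at hs
  have htc : (t : ℂ) ≠ 0 := by exact_mod_cast ht.ne'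
  have h1 : HasDerivAt (fun t : ℝ => (t : ℂ) ^ s) (s * (t : ℂ) ^ (s - 1)) t := by
    have := (hasDerivAt_id (t : ℂ)).cpow_const (c := s) (Or.inl (by simpa using ht))
    simpa using this.comp_ofReal
  have h2 : HasDerivAt (fun t : ℝ => besselEntire s (k * t))
      (besselEntire (s + 1) (k * t) * k) t := by
    have h3 : HasDerivAt (fun z : ℂ => k * z) k t := by
      simpa using (hasDerivAt_id (t : ℂ)).const_mul k
    exact ((hasDerivAt_besselEntire (by linarith) (k * t)).comp (t : ℂ) h3).comp_ofReal
  refine (h1.mul h2).congr_deriv ?_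
  have h4 := besselEntire_recurrence (ν := s - 1) (by simp; linarith) (k * t)
  have e1 : s - 1 + 2 = s + 1 := by ring
  have e2 : s - 1 + 1 = s := by ring
  rw [e1, e2] at h4
  rw [← h4, cpow_sub _ _ htc, cpow_one]
  field_simp
  ring

/-! ### The Bessel integral -/

/-- The integral `∫_0^∞ u^{a-1} exp(-qu - p/u) du`, a Bessel function of the second kind in
`2√(pq)`. It converges for `0 < re q` and either `0 < re p` or `p = 0`, `0 < re a`. -/
noncomputable def besselIntegral (a p q : ℂ) : ℂ :=
  mellin (fun u : ℝ => cexp (-(q * u) - p / u)) a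

lemma integrableOn_rpow_mul_exp {A P Q : ℝ} (hQ : 0 < Q) (hP : 0 ≤ P) (h : 0 < P ∨ 0 < A) :
    IntegrableOn (fun u : ℝ => u ^ (A - 1) * Real.exp (-(Q * u) - P / u)) (Ioi 0) := by
  have hmeas : AEStronglyMeasurable (fun u : ℝ => u ^ (A - 1) * Real.exp (-(Q * u) - P / u))
      (volume.restrict (Ioi 0)) := by
    refine ContinuousOn.aestronglyMeasurable (fun u (hu : 0 < u) => ?_) measurableSet_Ioi
    have : u ≠ 0 := hu.ne'
    exact (ContinuousAt.mul (Real.continuousAt_rpow_const _ _ (Or.inl this))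
      (by fun_prop (disch := assumption))).continuousWithinAt
  -- the factor `exp(-P/u)` is `O(u^N)` for every `N`
  obtain ⟨N, C, hN, hC⟩ : ∃ (N : ℕ) (C : ℝ), 0 < A + N ∧
      ∀ u : ℝ, 0 < u → Real.exp (-(P / u)) ≤ C * u ^ N := by
    rcases h with h | h
    · obtain ⟨N, hN⟩ := exists_nat_gt (-A)
      refine ⟨N, N ! * P⁻¹ ^ N, by linarith, fun u hu => ?_⟩
      have h1 := Real.pow_div_factorial_le_exp (P / u) (by positivity) N
      rw [Real.exp_neg, inv_le_comm₀ (Real.exp_pos _) (by positivity)]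
      refine le_trans (le_of_eq ?_) h1
      rw [div_pow, inv_pow]
      field_simp
    · refine ⟨0, 1, by simpa using h, fun u hu => ?_⟩
      simp
      positivity
  have hint := (integrableOn_rpow_mul_exp_neg_mul_rpow (p := 1) (s := A + N - 1) (b := Q)
    (by linarith) one_pos hQ).const_mul C
  refine Integrable.mono' hint hmeas ?_
  filter_upwards [ae_restrict_mem measurableSet_Ioi] with u hu
  have hu : 0 < u := hu
  rw [Real.norm_of_nonneg (by positivity), sub_eq_add_neg (-(Q * u)), Real.exp_add, Real.rpow_one]
  have e1 : u ^ (A + N - 1) = u ^ (A - 1) * u ^ N := by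
    rw [← Real.rpow_natCast u N, ← Real.rpow_add hu]; ring_nf
  rw [e1]
  calc _ ≤ u ^ (A - 1) * (Real.exp (-(Q * u)) * (C * u ^ N)) := by gcongr; exact hC u hu
    _ = _ := by ring_nf

lemma norm_cpow_mul_exp {a p q : ℂ} {u : ℝ} (hu : 0 < u) :
    ‖(u : ℂ) ^ (a - 1) • cexp (-(q * u) - p / u)‖ =
      u ^ (a.re - 1) * Real.exp (-(q.re * u) - p.re / u) := by
  rw [norm_smul, norm_cpow_eq_rpow_re_of_pos hu, norm_exp]
  simp [div_ofReal_re]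

lemma continuousOn_cpow_mul_exp (a p q : ℂ) :
    ContinuousOn (fun u : ℝ => (u : ℂ) ^ (a - 1) • cexp (-(q * u) - p / u)) (Ioi 0) := by
  intro u (hu : 0 < u)
  have : (u : ℂ) ≠ 0 := by exact_mod_cast hu.ne'
  exact (ContinuousAt.smul (continuousAt_ofReal_cpow_const _ _ (Or.inr hu.ne'))
    (by fun_prop (disch := assumption))).continuousWithinAt

lemma mellinConvergent_besselIntegral {a p q : ℂ} (hq : 0 < q.re) (hp : 0 ≤ p.re)
    (h : 0 < p.re ∨ 0 < a.re) :
    MellinConvergent (fun u : ℝ => cexp (-(q * u) - p / u)) a := by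
  refine Integrable.mono' (integrableOn_rpow_mul_exp hq hp h)
    ((continuousOn_cpow_mul_exp a p q).aestronglyMeasurable measurableSet_Ioi) ?_
  filter_upwards [ae_restrict_mem measurableSet_Ioi] with u hu
  exact (norm_cpow_mul_exp hu).le

lemma hasDerivAt_besselIntegral {a p q : ℂ} (hq : 0 < q.re) (hp : 0 ≤ p.re)
    (h : 0 < p.re ∨ 0 < a.re) :
    HasDerivAt (besselIntegral a p) (-besselIntegral (a + 1) p q) q := by
  set μ := volume.restrict (Ioi (0 : ℝ))
  have hs : {y : ℂ | q.re / 2 < y.re} ∈ 𝓝 q :=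
    (isOpen_lt continuous_const continuous_re).mem_nhds (by simp; linarith)
  have main := hasDerivAt_integral_of_dominated_loc_of_deriv_le (μ := μ) (x₀ := q)
    (F := fun y (u : ℝ) => (u : ℂ) ^ (a - 1) • cexp (-(y * u) - p / u))
    (F' := fun y (u : ℝ) => -((u : ℂ) ^ (a + 1 - 1) • cexp (-(y * u) - p / u)))
    (bound := fun u : ℝ => u ^ ((a + 1).re - 1) * Real.exp (-(q.re / 2 * u) - p.re / u))
    hs (Eventually.of_forall fun y =>
      (continuousOn_cpow_mul_exp a p y).aestronglyMeasurable measurableSet_Ioi)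
    (mellinConvergent_besselIntegral hq hp h)
    ((continuousOn_cpow_mul_exp (a + 1) p q).aestronglyMeasurable measurableSet_Ioi).neg
    ?_ (integrableOn_rpow_mul_exp (by linarith) hp (h.imp id fun h => by simp; linarith)) ?_
  · refine main.2.congr_deriv ?_
    rw [integral_neg]; rfl
  · filter_upwards [ae_restrict_mem measurableSet_Ioi] with u hu y hy
    have hu : 0 < u := hu
    have hy : q.re / 2 < y.re := hy
    rw [norm_neg, norm_cpow_mul_exp hu]
    gcongr
  · filter_upwards [ae_restrict_mem measurableSet_Ioi] with u hu y hy
    have hu : 0 < u := hu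
    have huc : (u : ℂ) ≠ 0 := by exact_mod_cast hu.ne'
    have h1 : HasDerivAt (fun y : ℂ => -(y * u) - p / u) (-(1 * (u : ℂ))) y :=
      ((hasDerivAt_id y).mul_const _).neg.sub_const _
    refine (h1.cexp.const_smul ((u : ℂ) ^ (a - 1))).congr_deriv ?_
    rw [add_sub_cancel_right, smul_eq_mul, smul_eq_mul, cpow_sub _ _ huc, cpow_one]
    field_simp

lemma besselIntegral_inv (a p q : ℂ) : besselIntegral a p q = besselIntegral (-a) q p := by
  rw [besselIntegral, besselIntegral, ← mellin_comp_inv]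
  congr 1
  ext u
  push_cast
  rw [div_inv_eq_mul, div_eq_mul_inv]
  ring_nf

lemma besselIntegral_mul {a p q : ℂ} {t : ℝ} (ht : 0 < t) :
    besselIntegral a p (q * t) = (t : ℂ) ^ (-a) * besselIntegral a (p * t) q := by
  have := mellin_comp_mul_left (fun u : ℝ => cexp (-(q * u) - p * t / u)) a ht
  rw [besselIntegral, besselIntegral, ← smul_eq_mul ((t : ℂ) ^ (-a)), ← this]
  congr 1
  ext u
  have htc : (t : ℂ) ≠ 0 := by exact_mod_cast ht.ne'
  push_cast
  rw [mul_comm (t : ℂ), mul_div_mul_right _ _ htc]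
  ring_nf

/-- Euler's integral with a complex rate: `∫_0^∞ u^{a-1} e^{-qu} du = Γ(a) q^{-a}`. -/
lemma besselIntegral_zero {a q : ℂ} (ha : 0 < a.re) (hq : 0 < q.re) :
    besselIntegral a 0 q = Gamma a * q ^ (-a) := by
  set U : Set ℂ := {q | 0 < q.re}
  have hU : IsOpen U := isOpen_lt continuous_const continuous_re
  have h1 : AnalyticOnNhd ℂ (besselIntegral a 0) U := DifferentiableOn.analyticOnNhd
    (fun q hq => (hasDerivAt_besselIntegral hq (by simp)
      (Or.inr ha)).differentiableAt.differentiableWithinAt) hU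
  have h2 : AnalyticOnNhd ℂ (fun q => Gamma a * q ^ (-a)) U := DifferentiableOn.analyticOnNhd
    (fun q hq => ((differentiableAt_id.cpow_const (Or.inl hq)).const_mul
      _).differentiableWithinAt) hU
  refine h1.eqOn_of_preconnected_of_frequently_eq h2
    (convex_halfSpace_re_gt 0).isPreconnected (z₀ := 1) (by simp [U]) ?_ hq
  have hreal : ∀ t : ℝ, 0 < t → besselIntegral a 0 t = Gamma a * (t : ℂ) ^ (-a) := by
    intro t ht
    have := integral_cpow_mul_exp_neg_mul_Ioi ha ht
    simp only [besselIntegral, mellin, smul_eq_mul, zero_div, sub_zero]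
    rw [this, mul_comm, one_div, cpow_neg, inv_cpow]
    rw [arg_ofReal_of_nonneg ht.le]
    exact Real.pi_pos.ne
  have hlim : Tendsto (fun t : ℝ => (t : ℂ)) (𝓝[≠] 1) (𝓝[≠] 1) := by
    refine tendsto_nhdsWithin_iff.2 ⟨?_, ?_⟩
    · exact (continuous_ofReal.tendsto' 1 1 (by simp)).mono_left nhdsWithin_le_nhds
    · filter_upwards [self_mem_nhdsWithin] with t ht
      simpa using ht
  refine hlim.frequently (Eventually.frequently ?_)
  filter_upwards [nhdsWithin_le_nhds (lt_mem_nhds (zero_lt_one' ℝ))] with t ht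
  exact hreal t ht

lemma tendsto_besselIntegral_zero {a p q : ℂ} (ha : 0 < a.re) (hp : 0 < p.re) (hq : 0 < q.re) :
    Tendsto (fun t : ℝ => besselIntegral a (p * t) q) (𝓝[>] 0) (𝓝 (Gamma a * q ^ (-a))) := by
  rw [← besselIntegral_zero ha hq]
  refine tendsto_integral_filter_of_dominated_convergence
    (fun u : ℝ => u ^ (a.re - 1) * Real.exp (-(q.re * u) - 0 / u))
    (Eventually.of_forall fun t =>
      (continuousOn_cpow_mul_exp a (p * t) q).aestronglyMeasurable measurableSet_Ioi) ?_
    (integrableOn_rpow_mul_exp hq le_rfl (Or.inr ha)) ?_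
  · filter_upwards [self_mem_nhdsWithin] with t ht
    have ht : 0 < t := ht
    filter_upwards [ae_restrict_mem measurableSet_Ioi] with u hu
    have hu : 0 < u := hu
    rw [norm_cpow_mul_exp hu]
    gcongr
    simp
    positivity
  · filter_upwards [ae_restrict_mem measurableSet_Ioi] with u hu
    have hu : 0 < u := hu
    have : Continuous fun t : ℝ => (u : ℂ) ^ (a - 1) • cexp (-(q * u) - p * t / u) := by fun_prop
    exact (this.tendsto' 0 _ (by simp)).mono_left nhdsWithin_le_nhds

/-- The Wronskian `f g* - f* g` of two solutions of `f' = t^{w-1} f*`, `f*' = k t^{-w} f` on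
`(0, ∞)` is constant, hence equal to its limit at `0`. -/
lemma wronskian_eq {f fs g gs : ℝ → ℂ} {w k c : ℂ}
    (hf : ∀ t : ℝ, 0 < t → HasDerivAt f ((t : ℂ) ^ (w - 1) * fs t) t)
    (hfs : ∀ t : ℝ, 0 < t → HasDerivAt fs (k * (t : ℂ) ^ (-w) * f t) t)
    (hg : ∀ t : ℝ, 0 < t → HasDerivAt g ((t : ℂ) ^ (w - 1) * gs t) t)
    (hgs : ∀ t : ℝ, 0 < t → HasDerivAt gs (k * (t : ℂ) ^ (-w) * g t) t)
    (hlim : Tendsto (fun t => f t * gs t - fs t * g t) (𝓝[>] 0) (𝓝 c)) :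
    f 1 * gs 1 - fs 1 * g 1 = c := by
  have hder : ∀ t ∈ Ioi (0 : ℝ), HasDerivAt (fun t => f t * gs t - fs t * g t) 0 t := by
    intro t ht
    refine (((hf t ht).mul (hgs t ht)).sub ((hfs t ht).mul (hg t ht))).congr_deriv ?_
    ring
  have hconst : ∀ t ∈ Ioi (0 : ℝ), f t * gs t - fs t * g t = f 1 * gs 1 - fs 1 * g 1 := by
    intro t ht
    exact (convex_Ioi (0 : ℝ)).is_const_of_fderivWithin_eq_zero (𝕜 := ℝ)
      (f := fun t => f t * gs t - fs t * g t)
      (fun x hx => (hder x hx).differentiableAt.differentiableWithinAt)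
      (fun x hx => by
        rw [fderivWithin_of_isOpen isOpen_Ioi hx]
        ext
        simpa using (hder x hx).deriv) ht (mem_Ioi.2 one_pos)
  refine tendsto_nhds_unique (Tendsto.congr' ?_ tendsto_const_nhds) hlim
  filter_upwards [self_mem_nhdsWithin] with t ht
  exact (hconst t ht).symm

lemma tendsto_ofReal_cpow_zero {s : ℂ} (hs : 0 < s.re) :
    Tendsto (fun t : ℝ => (t : ℂ) ^ s) (𝓝[>] 0) (𝓝 0) := by
  have hs0 : s ≠ 0 := fun h => by simp [h] at hs
  have := (continuousAt_ofReal_cpow_const 0 s (Or.inl hs)).tendsto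
  rw [ofReal_zero, zero_cpow hs0] at this
  exact this.mono_left nhdsWithin_le_nhds

/-- The expansion of the Bessel integral at its branch point: for `0 < re w < 1`,
`∫_0^∞ u^{w-1} e^{-qu-p/u} du = π / sin(πw) (q^{-w} E_{-w}(pq) - p^w E_w(pq))`. Along the ray
`t ↦ tp` all three terms solve the same second-order equation, so the coefficients can be read off
from Wronskians at `t = 0`. -/
theorem besselIntegral_eq {w p q : ℂ} (hw0 : 0 < w.re) (hw1 : w.re < 1) (hp : 0 < p.re)
    (hq : 0 < q.re) :
    besselIntegral w p q = Real.pi / Complex.sin (Real.pi * w) *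
      (q ^ (-w) * besselEntire (-w) (p * q) - p ^ w * besselEntire w (p * q)) := by
  have hp0 : p ≠ 0 := fun h => by simp [h] at hp
  set k := p * q with hk
  set f : ℝ → ℂ := fun t => besselIntegral w (p * t) q
  set fs : ℝ → ℂ := fun t => -p * besselIntegral (w - 1) p (q * t)
  set f₁ : ℝ → ℂ := fun t => besselEntire (-w) (k * t)
  set f₁s : ℝ → ℂ := fun t => k * ((t : ℂ) ^ (1 - w) * besselEntire (1 - w) (k * t))
  set f₂ : ℝ → ℂ := fun t => (t : ℂ) ^ w * besselEntire w (k * t)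
  set f₂s : ℝ → ℂ := fun t => besselEntire (w - 1) (k * t)
  have hmul : ∀ (z : ℂ) (t : ℝ), HasDerivAt (fun x : ℂ => z * x) z t := fun z t => by
    simpa using (hasDerivAt_id (t : ℂ)).const_mul z
  have re_mul : ∀ (z : ℂ) (t : ℝ), (z * t).re = z.re * t := fun z t => by simp
  have hf : ∀ t : ℝ, 0 < t → HasDerivAt f ((t : ℂ) ^ (w - 1) * fs t) t := by
    intro t ht
    have htc : (t : ℂ) ≠ 0 := by exact_mod_cast ht.ne'
    have h1 : f = fun t : ℝ => besselIntegral (-w) q (p * t) := by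
      ext t; exact besselIntegral_inv _ _ _
    rw [h1]
    have hpt : 0 < (p * t).re := by rw [re_mul]; positivity
    refine ((hasDerivAt_besselIntegral hpt hq.le (Or.inl hq)).comp (t : ℂ)
      (hmul p t)).comp_ofReal.congr_deriv ?_
    simp only [fs]
    rw [besselIntegral_mul (a := w - 1) ht, besselIntegral_inv (w - 1) (p * t) q]
    have : (t : ℂ) ^ (w - 1) * (t : ℂ) ^ (-(w - 1)) = 1 := by
      rw [← cpow_add _ _ htc]; simp
    have e1 : -(w - 1) = -w + 1 := by ring
    rw [e1] at this ⊢
    linear_combination (-this) * -p * besselIntegral (-w + 1) q (p * t)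
  have hfs : ∀ t : ℝ, 0 < t → HasDerivAt fs (k * (t : ℂ) ^ (-w) * f t) t := by
    intro t ht
    have hqt : 0 < (q * t).re := by rw [re_mul]; positivity
    refine (((hasDerivAt_besselIntegral hqt hp.le (Or.inl hp)).comp (t : ℂ)
      (hmul q t)).comp_ofReal.const_mul (-p)).congr_deriv ?_
    rw [sub_add_cancel, besselIntegral_mul ht]
    simp only [f, hk]
    ring
  have hf₁ : ∀ t : ℝ, 0 < t → HasDerivAt f₁ ((t : ℂ) ^ (w - 1) * f₁s t) t := by
    intro t ht
    have htc : (t : ℂ) ≠ 0 := by exact_mod_cast ht.ne'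
    refine ((hasDerivAt_besselEntire (ν := -w) (by simp; linarith) (k * t)).comp (t : ℂ)
      (hmul k t)).comp_ofReal.congr_deriv ?_
    have : (t : ℂ) ^ (w - 1) * (t : ℂ) ^ (1 - w) = 1 := by
      rw [← cpow_add _ _ htc]; simp
    have e1 : -w + 1 = 1 - w := by ring
    rw [e1]
    simp only [f₁s]
    linear_combination (-this) * k * besselEntire (1 - w) (k * t)
  have hf₁s : ∀ t : ℝ, 0 < t → HasDerivAt f₁s (k * (t : ℂ) ^ (-w) * f₁ t) t := by
    intro t ht
    have := (hasDerivAt_cpow_mul_besselEntire (s := 1 - w) (k := k) (by simp; linarith)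
      ht).const_mul k
    refine this.congr_deriv ?_
    have e1 : 1 - w - 1 = -w := by ring
    rw [e1]
    simp only [f₁]
    ring
  have hf₂ : ∀ t : ℝ, 0 < t → HasDerivAt f₂ ((t : ℂ) ^ (w - 1) * f₂s t) t := fun t ht =>
    hasDerivAt_cpow_mul_besselEntire hw0 ht
  have hf₂s : ∀ t : ℝ, 0 < t → HasDerivAt f₂s (k * (t : ℂ) ^ (-w) * f₂ t) t := by
    intro t ht
    have htc : (t : ℂ) ≠ 0 := by exact_mod_cast ht.ne'
    refine ((hasDerivAt_besselEntire (ν := w - 1) (by simp; linarith) (k * t)).comp (t : ℂ)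
      (hmul k t)).comp_ofReal.congr_deriv ?_
    have : (t : ℂ) ^ (-w) * (t : ℂ) ^ w = 1 := by
      rw [← cpow_add _ _ htc]; simp
    rw [sub_add_cancel]
    simp only [f₂]
    linear_combination (-this) * k * besselEntire w (k * t)
  -- the values at `t = 0`
  have lf : Tendsto f (𝓝[>] 0) (𝓝 (Gamma w * q ^ (-w))) := tendsto_besselIntegral_zero hw0 hp hq
  have lfs : Tendsto fs (𝓝[>] 0) (𝓝 (-(p ^ w * Gamma (1 - w)))) := by
    have h1 : fs = fun t : ℝ => -p * besselIntegral (1 - w) (q * t) p := by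
      ext t; simp only [fs]; rw [besselIntegral_inv]; ring_nf
    have h2 := (tendsto_besselIntegral_zero (a := 1 - w) (by simp; linarith) hq hp).const_mul (-p)
    rw [h1]
    convert h2 using 2
    have e1 : -(1 - w) = w - 1 := by ring
    rw [e1, cpow_sub _ _ hp0, cpow_one]
    field_simp
  have lE : ∀ ν : ℂ, -1 < ν.re →
      Tendsto (fun t : ℝ => besselEntire ν (k * t)) (𝓝[>] 0) (𝓝 (Gamma (ν + 1))⁻¹) := by
    intro ν hν
    have : Continuous fun t : ℝ => besselEntire ν (k * t) :=
      (continuous_besselEntire hν).comp (by fun_prop)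
    exact (this.tendsto' 0 _ (by simp [besselEntire_zero])).mono_left nhdsWithin_le_nhds
  have lf₁ : Tendsto f₁ (𝓝[>] 0) (𝓝 (Gamma (1 - w))⁻¹) := by
    have := lE (-w) (by simp; linarith)
    rwa [show -w + 1 = 1 - w by ring] at this
  have lf₁s : Tendsto f₁s (𝓝[>] 0) (𝓝 0) := by
    simpa using ((tendsto_ofReal_cpow_zero (s := 1 - w) (by simp; linarith)).mul
      (lE (1 - w) (by simp; linarith))).const_mul k
  have lf₂ : Tendsto f₂ (𝓝[>] 0) (𝓝 0) := by
    simpa using (tendsto_ofReal_cpow_zero hw0).mul (lE w (by linarith))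
  have lf₂s : Tendsto f₂s (𝓝[>] 0) (𝓝 (Gamma w)⁻¹) := by
    simpa using lE (w - 1) (by simp; linarith)
  have hGw : Gamma w ≠ 0 := Gamma_ne_zero_of_re_pos hw0
  have hGw1 : Gamma (1 - w) ≠ 0 := Gamma_ne_zero_of_re_pos (by simp; linarith)
  have W2 := wronskian_eq hf hfs hf₂ hf₂s ((lf.mul lf₂s).sub (lfs.mul lf₂))
  have W1 := wronskian_eq hf hfs hf₁ hf₁s ((lf.mul lf₁s).sub (lfs.mul lf₁))
  have W12 := wronskian_eq hf₁ hf₁s hf₂ hf₂s ((lf₁.mul lf₂s).sub (lf₁s.mul lf₂))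
  have hrefl := Gamma_mul_Gamma_one_sub w
  have hsin : Complex.sin (Real.pi * w) ≠ 0 := by
    intro h
    rw [h, div_zero] at hrefl
    exact mul_ne_zero hGw hGw1 hrefl
  have v0 : f 1 = besselIntegral w p q := by simp [f]
  have v1 : f₁ 1 = besselEntire (-w) k := by simp [f₁]
  have v2 : f₂ 1 = besselEntire w k := by simp [f₂]
  rw [← v0, ← v1, ← v2]
  have hpi : (Real.pi : ℂ) ≠ 0 := by exact_mod_cast Real.pi_ne_zero
  have hG12 : (Gamma (1 - w))⁻¹ * (Gamma w)⁻¹ = Complex.sin (Real.pi * w) / Real.pi := by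
    rw [← mul_inv, mul_comm, hrefl, inv_div]
  have W2' : f 1 * f₂s 1 - fs 1 * f₂ 1 = q ^ (-w) := by
    rw [W2]; field_simp; ring
  have W1' : f 1 * f₁s 1 - fs 1 * f₁ 1 = p ^ w := by
    rw [W1]; field_simp; ring
  have W12' : f₁ 1 * f₂s 1 - f₁s 1 * f₂ 1 = Complex.sin (Real.pi * w) / Real.pi := by
    rw [W12, ← hG12]; ring
  have key : f 1 * (Complex.sin (Real.pi * w) / Real.pi) = q ^ (-w) * f₁ 1 - p ^ w * f₂ 1 := by
    linear_combination (-f 1) * W12' + f₁ 1 * W2' - f₂ 1 * W1'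
  rw [← key]
  field_simp

/-! ### Mellin transforms of Fourier transforms -/

lemma continuousOn_integral_mul_of_hasCompactSupport {X : Type*} [TopologicalSpace X]
    [FirstCountableTopology X] {G : ℝ → ℂ} (hG : Continuous G) (hGc : HasCompactSupport G)
    {S : Set X} {k : X → ℝ → ℂ}
    (hk : ∀ p ∈ S, ∀ x ∈ tsupport G,
      ContinuousWithinAt (Function.uncurry k) (S ×ˢ univ) (p, x)) :
    ContinuousOn (fun p => ∫ x, G x * k p x) S := by
  refine continuousOn_integral_of_compact_support (k := tsupport G) hGc ?_ ?_
  · rintro ⟨p, x⟩ ⟨hp, -⟩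
    by_cases hx : x ∈ tsupport G
    · exact ContinuousWithinAt.mul (hG.comp continuous_snd).continuousWithinAt (hk p hp x hx)
    · have h0 : ∀ᶠ y in 𝓝 (p, x), Function.uncurry (fun p x => G x * k p x) y = 0 := by
        have hy : ∀ᶠ y in 𝓝 x, y ∉ tsupport G :=
          (isClosed_tsupport G).isOpen_compl.mem_nhds hx
        filter_upwards [continuousAt_snd.eventually hy] with y hy
        simp [Function.uncurry, image_eq_zero_of_notMem_tsupport hy]
      exact (continuousAt_const.congr (h0.mono fun y hy => hy.symm)).continuousWithinAt
  · intro p x _ hx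
    simp [image_eq_zero_of_notMem_tsupport hx]

/-- Abel summation of the Mellin transform of a Fourier transform: for `Φ(u) = ∫ G(x) e(σxu) dx`
and `p` of nonnegative real part, `∫_0^∞ u^{w-1} Φ(u) exp(-p(0)/u) du` is the limit for `ε → 0+` of
the integrals with `exp(-εu - p(ε)/u)`, where the order of integration can be interchanged. -/
theorem tendsto_integral_mul_besselIntegral {G Φ : ℝ → ℂ} (hG : Continuous G)
    (hGc : HasCompactSupport G) {σ : ℝ} {w : ℂ} (hw0 : 0 < w.re)
    (hΦ : ∀ u : ℝ, Φ u = ∫ x, G x * cexp (2 * Real.pi * I * σ * x * u))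
    (hΦi : MellinConvergent Φ w) {p : ℝ → ℂ} (hpc : Continuous p)
    (hp : ∀ ε, 0 < ε → 0 ≤ (p ε).re) :
    Tendsto (fun ε : ℝ => ∫ x, G x * besselIntegral w (p ε) (ε + -(2 * Real.pi * I * σ * x)))
      (𝓝[>] 0) (𝓝 (mellin (fun u : ℝ => Φ u * cexp (-p 0 / u)) w)) := by
  set q : ℝ → ℂ := fun x => -(2 * Real.pi * I * σ * x) with hq
  have hqre : ∀ x, (q x).re = 0 := fun x => by simp [hq]
  have hqc : Continuous q := by fun_prop
  set J : ℝ → ℂ := fun ε => mellin (fun u : ℝ => Φ u * cexp (-(ε * u) - p ε / u)) w with hJ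
  have hΦc : AEStronglyMeasurable (fun u : ℝ => (u : ℂ) ^ (w - 1) • Φ u)
      (volume.restrict (Ioi 0)) := hΦi.1
  have h1 : Tendsto J (𝓝[>] 0) (𝓝 (mellin (fun u : ℝ => Φ u * cexp (-p 0 / u)) w)) := by
    refine tendsto_integral_filter_of_dominated_convergence
      (fun u : ℝ => ‖(u : ℂ) ^ (w - 1) • Φ u‖) (Eventually.of_forall fun ε => ?_) ?_
      hΦi.norm ?_
    · simp only [smul_eq_mul, ← mul_assoc] at hΦc ⊢
      refine hΦc.mul (ContinuousOn.aestronglyMeasurable (fun u (hu : 0 < u) => ?_)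
        measurableSet_Ioi)
      have : (u : ℂ) ≠ 0 := by exact_mod_cast hu.ne'
      exact ContinuousAt.continuousWithinAt (by fun_prop (disch := assumption))
    · filter_upwards [self_mem_nhdsWithin] with ε hε
      have hε : 0 < ε := hε
      filter_upwards [ae_restrict_mem measurableSet_Ioi] with u hu
      have hu : 0 < u := hu
      rw [smul_eq_mul, smul_eq_mul, ← mul_assoc, norm_mul _ (cexp _)]
      refine mul_le_of_le_one_right (norm_nonneg _) ?_
      rw [norm_exp, Real.exp_le_one_iff]
      simp only [sub_re, neg_re, mul_re, ofReal_re, ofReal_im, div_ofReal_re]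
      have : 0 ≤ (p ε).re / u := div_nonneg (hp ε hε) hu.le
      have : 0 < ε * u := by positivity
      simp; linarith
    · filter_upwards with u
      have : Continuous fun ε : ℝ =>
          (u : ℂ) ^ (w - 1) • (Φ u * cexp (-(ε * u) - p ε / u)) := by fun_prop
      exact (this.tendsto' 0 _ (by simp [neg_div])).mono_left nhdsWithin_le_nhds
  refine h1.congr' ?_
  filter_upwards [self_mem_nhdsWithin] with ε hε
  have hε : 0 < ε := hε
  have hA : Integrable (fun u : ℝ => (u : ℂ) ^ (w - 1) • cexp (-(ε * u) - p ε / u))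
      (volume.restrict (Ioi 0)) :=
    mellinConvergent_besselIntegral (q := ε) (by simpa using hε) (hp ε hε) (Or.inr hw0)
  have hAG := hA.mul_prod (hG.integrable_of_hasCompactSupport (μ := volume) hGc)
  have hint : Integrable (Function.uncurry fun (u x : ℝ) => cexp (-(q x * u)) *
      ((u : ℂ) ^ (w - 1) • cexp (-(ε * u) - p ε / u) * G x))
      ((volume.restrict (Ioi 0)).prod volume) := by
    refine hAG.bdd_mul (c := 1) (Continuous.aestronglyMeasurable (by fun_prop)) ?_
    filter_upwards with y
    rw [norm_exp]
    simp [hqre]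
  calc J ε = ∫ u in Ioi (0 : ℝ), ∫ x, cexp (-(q x * u)) *
      ((u : ℂ) ^ (w - 1) • cexp (-(ε * u) - p ε / u) * G x) := by
        refine setIntegral_congr_fun measurableSet_Ioi fun u hu => ?_
        simp only
        rw [hΦ, smul_eq_mul, mul_left_comm, ← integral_mul_const]
        refine integral_congr_ae (Eventually.of_forall fun x => ?_)
        simp only [hq, neg_mul, neg_neg, smul_eq_mul]
        ring
    _ = ∫ x, ∫ u in Ioi (0 : ℝ), cexp (-(q x * u)) *
      ((u : ℂ) ^ (w - 1) • cexp (-(ε * u) - p ε / u) * G x) := integral_integral_swap hint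
    _ = ∫ x, G x * besselIntegral w (p ε) (ε + q x) := by
        refine integral_congr_ae (Eventually.of_forall fun x => ?_)
        simp only [besselIntegral, mellin]
        rw [← integral_const_mul]
        refine setIntegral_congr_fun measurableSet_Ioi fun u hu => ?_
        simp only [smul_eq_mul]
        have : cexp (-((ε + q x) * u) - p ε / u) =
            cexp (-(q x * u)) * cexp (-(ε * u) - p ε / u) := by
          rw [← Complex.exp_add]; ring_nf
        rw [this]; ring

lemma im_two_pi_I_mul_ne_zero {σ x : ℝ} (hσ : σ ≠ 0) (hx : x ≠ 0) :
    (-(2 * Real.pi * I * σ * x)).im ≠ 0 := by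
  simp [Real.pi_ne_zero, hσ, hx]

/-- The Bessel transform behind the summation formula: for `Φ(u) = ∫ G(x) e(σxu) dx` the integral
`∫_0^∞ u^{w-1} Φ(u) e(-σξ/u) du` is an integral of `G` against Bessel functions. -/
theorem mellin_fourier_mul_exp {G Φ : ℝ → ℂ} (hG : Continuous G) (hGc : HasCompactSupport G)
    (hG0 : tsupport G ⊆ Ioi 0) {σ ξ : ℝ} (hσ : σ ≠ 0) (hξ : ξ ≠ 0) {w : ℂ} (hw0 : 0 < w.re)
    (hw1 : w.re < 1) (hΦ : ∀ u : ℝ, Φ u = ∫ x, G x * cexp (2 * Real.pi * I * σ * x * u))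
    (hΦi : MellinConvergent Φ w) :
    mellin (fun u : ℝ => Φ u * cexp (-(2 * Real.pi * I * σ * ξ) / u)) w =
      Real.pi / Complex.sin (Real.pi * w) * ∫ x, G x *
        ((-(2 * Real.pi * I * σ * x)) ^ (-w) *
            besselEntire (-w) (2 * Real.pi * I * σ * ξ * -(2 * Real.pi * I * σ * x)) -
          (2 * Real.pi * I * σ * ξ) ^ w *
            besselEntire w (2 * Real.pi * I * σ * ξ * -(2 * Real.pi * I * σ * x))) := by
  set P : ℂ := 2 * Real.pi * I * σ * ξ with hP
  have hPre : P.re = 0 := by simp [hP]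
  have hPim : P.im ≠ 0 := by simp [hP, Real.pi_ne_zero, hσ, hξ]
  set k : ℝ → ℝ → ℂ := fun ε x =>
    (ε + -(2 * Real.pi * I * σ * x)) ^ (-w) *
      besselEntire (-w) ((ε + P) * (ε + -(2 * Real.pi * I * σ * x))) -
    (ε + P) ^ w * besselEntire w ((ε + P) * (ε + -(2 * Real.pi * I * σ * x))) with hk
  have h1 := tendsto_integral_mul_besselIntegral hG hGc hw0 hΦ hΦi (p := fun ε => ε + P)
    (by fun_prop) (fun ε hε => by simp [hPre, hε.le])
  have h3 : Tendsto (fun ε => ∫ x, G x * k ε x) (𝓝[>] 0) (𝓝 (∫ x, G x * k 0 x)) := by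
    have hc : ContinuousOn (fun ε => ∫ x, G x * k ε x) (Ici (0 : ℝ)) := by
      refine continuousOn_integral_mul_of_hasCompactSupport hG hGc fun ε hε x hx => ?_
      refine ContinuousAt.continuousWithinAt ?_
      have hx0 : x ≠ 0 := (hG0 hx).ne'
      have c1 : ContinuousAt (fun y : ℝ × ℝ => ((y.1 : ℂ) + -(2 * Real.pi * I * σ * y.2)))
        (ε, x) := by fun_prop
      have c2 : ContinuousAt (fun y : ℝ × ℝ => ((y.1 : ℂ) + P)) (ε, x) := by fun_prop
      have e1 := continuous_besselEntire (ν := -w) (by simp; linarith)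
      have e2 := continuous_besselEntire (ν := w) (by linarith)
      refine ContinuousAt.sub (ContinuousAt.mul ?_ ?_) (ContinuousAt.mul ?_ ?_)
      · refine ContinuousAt.cpow c1 continuousAt_const (Or.inr ?_)
        rw [add_im, ofReal_im, zero_add]
        exact im_two_pi_I_mul_ne_zero hσ hx0
      · exact e1.continuousAt.comp' (c2.mul c1)
      · exact ContinuousAt.cpow c2 continuousAt_const (Or.inr (by simpa using hPim))
      · exact e2.continuousAt.comp' (c2.mul c1)
    exact (hc 0 self_mem_Ici).tendsto.mono_left (nhdsWithin_mono _ Ioi_subset_Ici_self)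
  have h4 := h3.const_mul (Real.pi / Complex.sin (Real.pi * w))
  simp only [hk, ofReal_zero, zero_add] at h1 h4
  refine tendsto_nhds_unique h1 (h4.congr' ?_)
  filter_upwards [self_mem_nhdsWithin] with ε hε
  have hε : 0 < ε := hε
  rw [← integral_const_mul]
  refine integral_congr_ae (Eventually.of_forall fun x => ?_)
  simp only
  rw [besselIntegral_eq hw0 hw1 (by simp [hPre, hε]) (by simp [hε])]
  ring

/-- The Mellin transform of a Fourier transform, in the half plane `0 < re w` where it converges at
the origin. -/
theorem mellin_fourier {G Φ : ℝ → ℂ} (hG : Continuous G) (hGc : HasCompactSupport G)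
    (hG0 : tsupport G ⊆ Ioi 0) {σ : ℝ} (hσ : σ ≠ 0) {w : ℂ} (hw0 : 0 < w.re)
    (hΦ : ∀ u : ℝ, Φ u = ∫ x, G x * cexp (2 * Real.pi * I * σ * x * u))
    (hΦi : MellinConvergent Φ w) :
    mellin Φ w = Gamma w * ∫ x, G x * (-(2 * Real.pi * I * σ * x)) ^ (-w) := by
  have h1 := tendsto_integral_mul_besselIntegral hG hGc hw0 hΦ hΦi (p := fun _ => 0)
    (by fun_prop) (by simp)
  set k : ℝ → ℝ → ℂ := fun ε x => (ε + -(2 * Real.pi * I * σ * x)) ^ (-w) with hk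
  have hc : ContinuousOn (fun ε => ∫ x, G x * k ε x) (Ici (0 : ℝ)) := by
    refine continuousOn_integral_mul_of_hasCompactSupport hG hGc fun ε hε x hx => ?_
    refine ContinuousAt.continuousWithinAt ?_
    refine ContinuousAt.cpow (by fun_prop) continuousAt_const (Or.inr ?_)
    rw [add_im, ofReal_im, zero_add]
    exact im_two_pi_I_mul_ne_zero hσ (hG0 hx).ne'
  have h4 := ((hc 0 self_mem_Ici).tendsto.mono_left
    (nhdsWithin_mono _ Ioi_subset_Ici_self)).const_mul (Gamma w)
  simp only [hk, ofReal_zero, zero_add, neg_zero, zero_div, Complex.exp_zero, mul_one] at h1 h4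
  refine tendsto_nhds_unique h1 (h4.congr' ?_)
  filter_upwards [self_mem_nhdsWithin] with ε hε
  have hε : 0 < ε := hε
  rw [← integral_const_mul]
  refine integral_congr_ae (Eventually.of_forall fun x => ?_)
  simp only
  rw [besselIntegral_zero hw0 (by simp [hε])]
  ring

/-! ### Twisted Mellin transforms of Schwartz functions -/

/-- The twisted Mellin transform `∫_0^∞ u^{s-1} Φ(u) e(-ξ/u) du`. -/
noncomputable def twistedMellin (Φ : ℝ → ℂ) (ξ : ℝ) (s : ℂ) : ℂ :=
  mellin (fun u : ℝ => Φ u * cexp (-(2 * Real.pi * I * ξ) / u)) s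

lemma norm_twist (ξ u : ℝ) : ‖cexp (-(2 * Real.pi * I * ξ) / u)‖ = 1 := by
  rw [norm_exp, div_ofReal_re]; simp

section

variable (Φ : 𝓢(ℝ, ℂ)) (ξ : ℝ)

lemma continuousOn_twist : ContinuousOn (fun u : ℝ => Φ u * cexp (-(2 * Real.pi * I * ξ) / u))
    (Ioi 0) := by
  intro u (hu : 0 < u)
  have : (u : ℂ) ≠ 0 := by exact_mod_cast hu.ne'
  exact (ContinuousAt.mul Φ.continuous.continuousAt
    (by fun_prop (disch := assumption))).continuousWithinAt

lemma twist_isBigO_atTop (a : ℝ) :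
    (fun u : ℝ => Φ u * cexp (-(2 * Real.pi * I * ξ) / u)) =O[atTop] (· ^ (-a)) := by
  have h1 : (fun u : ℝ => Φ u) =O[atTop] (fun u : ℝ => ‖u‖ ^ (-a)) :=
    (Φ.isBigO_cocompact_rpow (-a)).mono atTop_le_cocompact
  refine Asymptotics.IsBigO.trans (Asymptotics.isBigO_of_le _ fun u => ?_ :
    _ =O[atTop] (fun u : ℝ => Φ u)) (h1.congr' EventuallyEq.rfl ?_)
  · rw [norm_mul, norm_twist, mul_one]
  · filter_upwards [eventually_ge_atTop 0] with u hu
    rw [Real.norm_of_nonneg hu]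

lemma twist_isBigO_zero :
    (fun u : ℝ => Φ u * cexp (-(2 * Real.pi * I * ξ) / u)) =O[𝓝[>] 0] (· ^ (-(0 : ℝ))) := by
  have h1 : (fun u : ℝ => Φ u) =O[𝓝[>] 0] (fun _ : ℝ => (1 : ℝ)) :=
    (Φ.continuous.continuousAt.tendsto.mono_left nhdsWithin_le_nhds).isBigO_one ℝ
  refine Asymptotics.IsBigO.trans (Asymptotics.isBigO_of_le _ fun u => ?_ :
    _ =O[𝓝[>] 0] (fun u : ℝ => Φ u)) (by simpa using h1)
  rw [norm_mul, norm_twist, mul_one]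

lemma mellinConvergent_twist {s : ℂ} (hs : 0 < s.re) :
    MellinConvergent (fun u : ℝ => Φ u * cexp (-(2 * Real.pi * I * ξ) / u)) s :=
  mellinConvergent_of_isBigO_rpow ((continuousOn_twist Φ ξ).locallyIntegrableOn measurableSet_Ioi)
    (twist_isBigO_atTop Φ ξ (s.re + 1)) (by linarith) (twist_isBigO_zero Φ ξ) hs

lemma mellinConvergent_schwartz {s : ℂ} (hs : 0 < s.re) : MellinConvergent Φ s := by
  simpa using mellinConvergent_twist Φ 0 hs

lemma differentiableAt_twistedMellin {s : ℂ} (hs : 0 < s.re) :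
    DifferentiableAt ℂ (twistedMellin Φ ξ) s :=
  mellin_differentiableAt_of_isBigO_rpow
    ((continuousOn_twist Φ ξ).locallyIntegrableOn measurableSet_Ioi)
    (twist_isBigO_atTop Φ ξ (s.re + 1)) (by linarith) (twist_isBigO_zero Φ ξ) hs

/-- In a vertical strip the twisted Mellin transform is bounded uniformly in the twist. -/
lemma exists_norm_twistedMellin_le (K : ℝ) :
    ∃ C : ℝ, 0 ≤ C ∧ ∀ (ξ : ℝ) (s : ℂ), 1 ≤ s.re → s.re ≤ K → ‖twistedMellin Φ ξ s‖ ≤ C := by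
  by_cases hK : 1 ≤ K
  swap
  · exact ⟨0, le_rfl, fun ξ s h1 h2 => absurd (h1.trans h2) hK⟩
  have i1 := (mellinConvergent_schwartz Φ (s := 1) (by simp)).norm
  have i2 := (mellinConvergent_schwartz Φ (s := K) (by simp; linarith)).norm
  refine ⟨∫ u in Ioi (0 : ℝ), (‖(u : ℂ) ^ ((1 : ℂ) - 1) • Φ u‖ + ‖(u : ℂ) ^ ((K : ℂ) - 1) • Φ u‖),
    integral_nonneg fun u => by positivity, fun ξ s h1 h2 => ?_⟩
  refine norm_integral_le_of_norm_le (i1.add i2) ?_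
  filter_upwards [ae_restrict_mem measurableSet_Ioi] with u hu
  have hu : 0 < u := hu
  simp only [norm_smul, norm_mul, norm_twist, norm_cpow_eq_rpow_re_of_pos hu, mul_one]
  rw [← add_mul]
  gcongr
  simp only [sub_re, one_re, ofReal_re, sub_self, zero_re, Real.rpow_zero]
  rcases le_total u 1 with h | h
  · have := Real.rpow_le_one hu.le h (z := s.re - 1) (by linarith)
    have : 0 ≤ u ^ (K - 1) := by positivity
    linarith
  · have := Real.rpow_le_rpow_of_exponent_le h (y := s.re - 1) (z := K - 1) (by linarith)
    linarith

variable {ξ}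

/-- Integration by parts against the oscillating factor `e(-ξ/u)`. -/
lemma twistedMellin_eq_by_parts (hξ : ξ ≠ 0) {s : ℂ} (hs : 0 < s.re) :
    twistedMellin Φ ξ s = -(2 * Real.pi * I * ξ)⁻¹ *
      ((s + 1) * twistedMellin Φ ξ (s + 1) +
        twistedMellin (SchwartzMap.derivCLM ℂ ℂ Φ) ξ (s + 2)) := by
  set Φ' := SchwartzMap.derivCLM ℂ ℂ Φ with hΦ'
  set κ : ℂ := 2 * Real.pi * I * ξ with hκ
  have hκ0 : κ ≠ 0 := by simp [hκ, Real.pi_ne_zero, hξ]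
  set E : ℝ → ℂ := fun u => cexp (-κ / u) with hE
  have c0 := mellinConvergent_twist Φ ξ hs
  have c1 := mellinConvergent_twist Φ ξ (s := s + 1) (by simp; linarith)
  have c2 := mellinConvergent_twist Φ ξ (s := s + 2) (by simp; linarith)
  have c3 := mellinConvergent_twist Φ' ξ (s := s + 2) (by simp; linarith)
  set F : ℝ → ℂ := fun u => (u : ℂ) ^ (s + 2 - 1) • (Φ u * E u) with hF
  set F' : ℝ → ℂ := fun u => (s + 1) * ((u : ℂ) ^ (s + 1 - 1) • (Φ u * E u)) +
    (u : ℂ) ^ (s + 2 - 1) • (Φ' u * E u) + κ * ((u : ℂ) ^ (s - 1) • (Φ u * E u)) with hF'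
  have hder : ∀ u ∈ Ioi (0 : ℝ), HasDerivAt F (F' u) u := by
    intro u (hu : 0 < u)
    have huc : (u : ℂ) ≠ 0 := by exact_mod_cast hu.ne'
    have d1 : HasDerivAt (fun u : ℝ => (u : ℂ) ^ (s + 2 - 1))
        ((s + 2 - 1) * (u : ℂ) ^ (s + 2 - 1 - 1)) u := by
      have := (hasDerivAt_id (u : ℂ)).cpow_const (c := s + 2 - 1) (Or.inl (by simpa using hu))
      simpa using this.comp_ofReal
    have d2 : HasDerivAt Φ (Φ' u) u := by
      simpa [hΦ'] using Φ.differentiableAt.hasDerivAt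
    have d3 : HasDerivAt E (E u * (κ / u ^ 2)) u := by
      have h := (((hasDerivAt_inv huc).const_mul (-κ)).cexp).comp_ofReal
      refine (h.congr_deriv ?_).congr_of_eventuallyEq ?_
      · simp only [hE, div_eq_mul_inv]; ring
      · exact Eventually.of_forall fun x => by simp only [hE, div_eq_mul_inv]
    refine (d1.smul (d2.mul d3)).congr_deriv ?_
    have e1 : (u : ℂ) ^ (s + 1 - 1) = (u : ℂ) ^ (s - 1) * u := by
      rw [show s + 1 - 1 = s - 1 + 1 by ring, cpow_add _ _ huc, cpow_one]
    have e2 : (u : ℂ) ^ (s + 2 - 1) = (u : ℂ) ^ (s - 1) * u ^ 2 := by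
      rw [show s + 2 - 1 = s - 1 + (2 : ℕ) by push_cast; ring, cpow_add _ _ huc, cpow_natCast]
    have e3 : (u : ℂ) ^ (s + 2 - 1 - 1) = (u : ℂ) ^ (s - 1) * u := by
      rw [show s + 2 - 1 - 1 = s - 1 + 1 by ring, cpow_add _ _ huc, cpow_one]
    simp only [hF', smul_eq_mul, e1, e2, e3, Pi.mul_apply]
    field_simp
    ring
  have hint : IntegrableOn F' (Ioi 0) :=
    ((c1.const_mul _).add c3).add (c0.const_mul _)
  have htop : Tendsto F atTop (𝓝 0) :=
    tendsto_zero_of_hasDerivAt_of_integrableOn_Ioi hder hint c2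
  have hcont : ContinuousWithinAt F (Ici 0) 0 := by
    have hF0 : F 0 = 0 := by
      have : s + 2 - 1 ≠ 0 := fun h => by
        have := congrArg re h; simp at this; linarith
      simp only [hF, ofReal_zero, zero_cpow this, zero_smul]
    rw [ContinuousWithinAt, hF0]
    refine squeeze_zero_norm (a := fun u : ℝ => ‖(u : ℂ) ^ (s + 2 - 1)‖ * ‖Φ u‖) (fun u => ?_) ?_
    · rw [hF, norm_smul, norm_mul, norm_twist, mul_one]
    · have hre : 0 < (s + 2 - 1).re := by simp; linarith
      have h0 : s + 2 - 1 ≠ 0 := fun h => by rw [h] at hre; simp at hre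
      have := Tendsto.mul (continuousAt_ofReal_cpow_const 0 (s + 2 - 1) (Or.inl hre)).norm.tendsto
        (Φ.continuous.norm.tendsto 0)
      simp only [ofReal_zero, zero_cpow h0, norm_zero, zero_mul] at this
      exact this.mono_left nhdsWithin_le_nhds
  have hF0 : F 0 = 0 := by
    have : s + 2 - 1 ≠ 0 := fun h => by
      have := congrArg re h; simp at this; linarith
    simp only [hF, ofReal_zero, zero_cpow this, zero_smul]
  have key := integral_Ioi_of_hasDerivAt_of_tendsto hcont hder hint htop
  rw [hF0, sub_zero] at key
  have hsplit : ∫ u in Ioi (0 : ℝ), F' u = (s + 1) * twistedMellin Φ ξ (s + 1) +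
      twistedMellin Φ' ξ (s + 2) + κ * twistedMellin Φ ξ s := by
    have i1 := integral_add ((c1.const_mul (s + 1)).add c3) (c0.const_mul κ)
    have i2 := integral_add (c1.const_mul (s + 1)) c3
    have i3 := integral_const_mul (μ := volume.restrict (Ioi 0)) (s + 1)
      fun u : ℝ => (u : ℂ) ^ (s + 1 - 1) • (Φ u * E u)
    have i4 := integral_const_mul (μ := volume.restrict (Ioi 0)) κ
      fun u : ℝ => (u : ℂ) ^ (s - 1) • (Φ u * E u)
    exact i1.trans (congrArg₂ _ (i2.trans (congrArg₂ _ i3 rfl)) i4)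
  rw [hsplit] at key
  field_simp
  linear_combination key

variable (ξ)

/-- The continuation of `twistedMellin Φ ξ` to the half plane `-2 < re s`, obtained by integrating
by parts twice; meaningful for `ξ ≠ 0`. -/
noncomputable def twistedMellinExt (s : ℂ) : ℂ :=
  ((2 * Real.pi * I * ξ)⁻¹) ^ 2 *
    ((s + 1) * (s + 2) * twistedMellin Φ ξ (s + 2) +
      (2 * s + 4) * twistedMellin (SchwartzMap.derivCLM ℂ ℂ Φ) ξ (s + 3) +
      twistedMellin (SchwartzMap.derivCLM ℂ ℂ (SchwartzMap.derivCLM ℂ ℂ Φ)) ξ (s + 4))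

variable {ξ} in
lemma twistedMellinExt_eq (hξ : ξ ≠ 0) {s : ℂ} (hs : 0 < s.re) :
    twistedMellinExt Φ ξ s = twistedMellin Φ ξ s := by
  have h1 := twistedMellin_eq_by_parts Φ hξ (s := s + 1) (by simp; linarith)
  have h2 := twistedMellin_eq_by_parts (SchwartzMap.derivCLM ℂ ℂ Φ) hξ (s := s + 2)
    (by simp; linarith)
  rw [twistedMellinExt, twistedMellin_eq_by_parts Φ hξ hs, h1, h2]
  rw [show s + 1 + 1 = s + 2 by ring, show s + 1 + 2 = s + 3 by ring,
    show s + 2 + 1 = s + 3 by ring, show s + 2 + 2 = s + 4 by ring]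
  ring

lemma differentiableAt_twistedMellinExt {s : ℂ} (hs : -2 < s.re) :
    DifferentiableAt ℂ (twistedMellinExt Φ ξ) s := by
  have h : ∀ (Ψ : 𝓢(ℝ, ℂ)) (c : ℂ), 0 < (s + c).re →
      DifferentiableAt ℂ (fun s => twistedMellin Ψ ξ (s + c)) s := fun Ψ c hc =>
    (differentiableAt_twistedMellin Ψ ξ hc).comp s (by fun_prop)
  have h2 := h Φ 2 (by simp; linarith)
  have h3 := h (SchwartzMap.derivCLM ℂ ℂ Φ) 3 (by simp; linarith)
  have h4 := h (SchwartzMap.derivCLM ℂ ℂ (SchwartzMap.derivCLM ℂ ℂ Φ)) 4 (by simp; linarith)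
  unfold twistedMellinExt
  fun_prop

lemma exists_norm_twistedMellinExt_le (K : ℝ) :
    ∃ C : ℝ, 0 ≤ C ∧ ∀ (ξ : ℝ) (s : ℂ), -1 ≤ s.re → ‖s‖ ≤ K →
      ‖twistedMellinExt Φ ξ s‖ ≤ C / ξ ^ 2 := by
  by_cases hK : 0 ≤ K
  swap
  · exact ⟨0, le_rfl, fun ξ s _ h2 => absurd ((norm_nonneg s).trans h2) hK⟩
  obtain ⟨C₀, h₀, H₀⟩ := exists_norm_twistedMellin_le Φ (K + 4)
  obtain ⟨C₁, h₁, H₁⟩ := exists_norm_twistedMellin_le (SchwartzMap.derivCLM ℂ ℂ Φ) (K + 4)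
  obtain ⟨C₂, h₂, H₂⟩ := exists_norm_twistedMellin_le
    (SchwartzMap.derivCLM ℂ ℂ (SchwartzMap.derivCLM ℂ ℂ Φ)) (K + 4)
  refine ⟨((2 * Real.pi)⁻¹) ^ 2 * ((K + 1) * (K + 2) * C₀ + (2 * K + 4) * C₁ + C₂),
    by positivity, fun ξ s hs hsK => ?_⟩
  have hre : s.re ≤ K := (re_le_norm s).trans hsK
  have n1 : ‖s + 1‖ ≤ K + 1 := (norm_add_le _ _).trans (by simpa using hsK)
  have n2 : ‖s + 2‖ ≤ K + 2 := (norm_add_le _ _).trans (by simpa using hsK)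
  have n3 : ‖2 * s + 4‖ ≤ 2 * K + 4 := (norm_add_le _ _).trans (by simpa using hsK)
  have b0 := H₀ ξ (s + 2) (by simp; linarith) (by simp; linarith)
  have b1 := H₁ ξ (s + 3) (by simp; linarith) (by simp; linarith)
  have b2 := H₂ ξ (s + 4) (by simp; linarith) (by simp; linarith)
  have e1 : ‖((2 * Real.pi * I * ξ)⁻¹) ^ 2‖ = ((2 * Real.pi)⁻¹) ^ 2 / ξ ^ 2 := by
    rw [norm_pow, norm_inv]
    simp [mul_pow, abs_of_pos Real.pi_pos]
    field_simp
  rw [twistedMellinExt, norm_mul, e1, div_mul_eq_mul_div]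
  gcongr
  refine (norm_add_le _ _).trans (add_le_add ((norm_add_le _ _).trans (add_le_add ?_ ?_)) b2)
  · rw [norm_mul, norm_mul]; gcongr
  · rw [norm_mul]; gcongr

end

/-! ### Poisson summation and inversion -/

section

lemma fourier_comp_mul_left (f : ℝ → ℂ) {κ : ℝ} (hκ : 0 < κ) (ξ : ℝ) :
    𝓕 (fun t => f (κ * t)) ξ = (κ : ℂ)⁻¹ * 𝓕 f (ξ / κ) := by
  rw [Real.fourier_real_eq_integral_exp_smul, Real.fourier_real_eq_integral_exp_smul]
  have := Measure.integral_comp_mul_left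
    (fun v : ℝ => cexp (↑(-2 * Real.pi * v * (ξ / κ)) * I) • f v) κ
  rw [abs_of_pos (inv_pos.2 hκ), real_smul, ofReal_inv] at this
  rw [← this]
  refine integral_congr_ae (Eventually.of_forall fun v => ?_)
  simp only
  congr 4
  field_simp

/-- Poisson summation over the shifted and dilated lattice `κ(y + ℤ)`. -/
lemma tsum_dilate_eq_tsum_fourier {f : ℝ → ℂ} (hf : Continuous f) {b : ℝ} (hb : 1 < b)
    (hfb : f =O[cocompact ℝ] fun x : ℝ => |x| ^ (-b)) {κ : ℝ} (hκ : 0 < κ)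
    (hs : Summable fun m : ℤ => 𝓕 f (m / κ)) (y : ℝ) :
    ∑' l : ℤ, f (κ * (y + l)) =
      (κ : ℂ)⁻¹ * ∑' m : ℤ, 𝓕 f (m / κ) * cexp (2 * Real.pi * I * (m * y : ℝ)) := by
  have hO : (fun t => f (κ * t)) =O[cocompact ℝ] fun x : ℝ => |x| ^ (-b) := by
    have ht : Tendsto (fun t : ℝ => κ * t) (cocompact ℝ) (cocompact ℝ) :=
      (Homeomorph.mulLeft₀ κ hκ.ne').isClosedEmbedding.tendsto_cocompact
    refine (hfb.comp_tendsto ht).trans ?_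
    have : ((fun x : ℝ => |x| ^ (-b)) ∘ fun t => κ * t) = fun t : ℝ => κ ^ (-b) * |t| ^ (-b) := by
      ext t
      simp [abs_mul, abs_of_pos hκ, Real.mul_rpow hκ.le (abs_nonneg t)]
    rw [this]
    exact Asymptotics.isBigO_const_mul_self _ _ _
  have hP := Real.tsum_eq_tsum_fourier_of_rpow_decay_of_summable
    (f := fun t => f (κ * t)) (by fun_prop) hb hO
    (by simpa only [fourier_comp_mul_left f hκ] using hs.mul_left _) y
  rw [hP, ← tsum_mul_left]
  refine tsum_congr fun m => ?_
  rw [fourier_comp_mul_left f hκ, fourier_coe_apply, mul_assoc]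
  push_cast
  ring_nf

/-- The function `t ↦ |t|^{-1-w} Φ(1/t)`. -/
noncomputable def invDilate (Φ : ℝ → ℂ) (w : ℂ) (t : ℝ) : ℂ :=
  ((|t| : ℝ) : ℂ) ^ (-1 - w) * Φ t⁻¹

variable (Φ : 𝓢(ℝ, ℂ)) {Ψ : 𝓢(ℝ, ℂ)}

lemma norm_invDilate {w : ℂ} {t : ℝ} (ht : t ≠ 0) :
    ‖invDilate Φ w t‖ = |t| ^ (-1 - w.re) * ‖Φ t⁻¹‖ := by
  rw [invDilate, norm_mul, norm_cpow_eq_rpow_re_of_pos (abs_pos.2 ht)]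
  simp

lemma invDilate_zero {w : ℂ} (hw : 0 < w.re) : invDilate Φ w 0 = 0 := by
  have : -1 - w ≠ 0 := fun h => by
    have := congrArg re h; simp at this; linarith
  simp [invDilate, zero_cpow this]

lemma continuous_invDilate {w : ℂ} (hw : 0 < w.re) : Continuous (invDilate Φ w) := by
  refine continuous_iff_continuousAt.2 fun t => ?_
  rcases eq_or_ne t 0 with rfl | ht
  · obtain ⟨k, hk⟩ := exists_nat_gt (1 + w.re)
    obtain ⟨C, hC0, hC⟩ := Φ.decay k 0
    rw [ContinuousAt, invDilate_zero Φ hw]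
    refine squeeze_zero_norm (a := fun t : ℝ => C * |t| ^ (k - 1 - w.re)) (fun t => ?_) ?_
    · rcases eq_or_ne t 0 with rfl | ht
      · rw [invDilate_zero Φ hw, norm_zero]
        positivity
      · rw [norm_invDilate Φ ht]
        have h1 := hC t⁻¹
        rw [norm_iteratedFDeriv_zero, norm_inv, Real.norm_eq_abs, inv_pow] at h1
        have ht' : 0 < |t| := abs_pos.2 ht
        have h2 : ‖Φ t⁻¹‖ ≤ C * |t| ^ k := by
          rwa [inv_mul_le_iff₀ (by positivity), mul_comm] at h1
        have e1 : |t| ^ ((k : ℝ) - 1 - w.re) = |t| ^ (-1 - w.re) * |t| ^ k := by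
          rw [← Real.rpow_natCast |t| k, ← Real.rpow_add ht']; ring_nf
        rw [e1]
        calc _ ≤ |t| ^ (-1 - w.re) * (C * |t| ^ k) := by gcongr
          _ = _ := by ring
    · have h3 : 0 < (k : ℝ) - 1 - w.re := by linarith
      have := ((continuous_abs.tendsto (0 : ℝ)).rpow_const (p := (k : ℝ) - 1 - w.re)
        (Or.inr h3.le)).const_mul C
      simpa [Real.zero_rpow h3.ne'] using this
  · have h1 : ContinuousAt (fun t : ℝ => ((|t| : ℝ) : ℂ) ^ (-1 - w)) t :=
      ContinuousAt.comp' (continuousAt_ofReal_cpow_const _ _ (Or.inr (abs_ne_zero.2 ht)))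
        continuous_abs.continuousAt
    exact h1.mul (ContinuousAt.comp' Φ.continuous.continuousAt (continuousAt_inv₀ ht))

lemma invDilate_isBigO {w : ℂ} :
    invDilate Φ w =O[cocompact ℝ] fun x : ℝ => |x| ^ (-(1 + w.re)) := by
  obtain ⟨C, hC0, hC⟩ := Φ.decay 0 0
  refine Asymptotics.IsBigO.of_bound C ?_
  have h0 : ∀ᶠ t : ℝ in cocompact ℝ, t ≠ 0 :=
    cocompact_le_cofinite (finite_singleton (0 : ℝ)).compl_mem_cofinite
  filter_upwards [h0] with t ht
  rw [norm_invDilate Φ ht, Real.norm_of_nonneg (by positivity), mul_comm C]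
  have h1 := hC t⁻¹
  rw [norm_iteratedFDeriv_zero, pow_zero, one_mul] at h1
  rw [neg_add']
  gcongr

variable {Φ}

/-- The substitution `t ↦ 1/t` turns the Fourier transform of `|t|^{-1-w} Φ(1/t)` into twisted
Mellin transforms of the two halves of `Φ`. -/
lemma fourier_invDilate (hΨ : ∀ u, Ψ u = Φ (-u)) {w : ℂ} (hw : 0 < w.re) (ξ : ℝ) :
    𝓕 (invDilate Φ w) ξ = twistedMellin Φ ξ w + twistedMellin Ψ (-ξ) w := by
  rw [Real.fourier_real_eq_integral_exp_smul]
  set g : ℝ → ℂ := fun v => cexp (↑(-2 * Real.pi * v * ξ) * I) • invDilate Φ w v with hg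
  have gpos : EqOn g (fun v : ℝ => (v : ℂ) ^ (-w - 1) •
      (fun u : ℝ => Φ u * cexp (-(2 * Real.pi * I * ξ) / u)) (v⁻¹)) (Ioi 0) := by
    intro v (hv : 0 < v)
    simp only [hg, invDilate, abs_of_pos hv, smul_eq_mul, ofReal_inv, div_inv_eq_mul]
    rw [show -w - 1 = -1 - w by ring]
    push_cast
    ring_nf
  have gneg : EqOn (fun v => g (-v)) (fun v : ℝ => (v : ℂ) ^ (-w - 1) •
      (fun u : ℝ => Ψ u * cexp (-(2 * Real.pi * I * (-ξ : ℝ)) / u)) (v⁻¹)) (Ioi 0) := by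
    intro v (hv : 0 < v)
    simp only [hg, invDilate, abs_neg, abs_of_pos hv, smul_eq_mul, ofReal_inv, div_inv_eq_mul, hΨ,
      inv_neg]
    rw [show -w - 1 = -1 - w by ring]
    push_cast
    ring_nf
  have conv : ∀ (Θ : 𝓢(ℝ, ℂ)) (η : ℝ), IntegrableOn (fun v : ℝ => (v : ℂ) ^ (-w - 1) •
      (fun u : ℝ => Θ u * cexp (-(2 * Real.pi * I * η) / u)) (v⁻¹)) (Ioi 0) := by
    intro Θ η
    have h := (MellinConvergent.comp_rpow
      (f := fun u : ℝ => Θ u * cexp (-(2 * Real.pi * I * η) / u)) (s := -w) (a := -1)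
      (by norm_num)).2 (by simpa using mellinConvergent_twist Θ η hw)
    refine h.congr_fun (fun v hv => ?_) measurableSet_Ioi
    simp only [Real.rpow_neg_one]
  have ipos : IntegrableOn g (Ioi 0) := (conv Φ ξ).congr_fun gpos.symm measurableSet_Ioi
  have ineg : IntegrableOn (fun v => g (-v)) (Ioi 0) :=
    (conv Ψ (-ξ)).congr_fun gneg.symm measurableSet_Ioi
  have ineg' : IntegrableOn g (Iic 0) := by
    have h1 : IntegrableOn (fun v => g (-v)) (Ici (-0)) := by
      rw [neg_zero]
      exact Iff.mpr integrableOn_Ici_iff_integrableOn_Ioi ineg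
    simpa using h1.comp_neg_Iic
  rw [← intervalIntegral.integral_Iic_add_Ioi ineg' ipos, add_comm]
  congr 1
  · rw [setIntegral_congr_fun measurableSet_Ioi gpos, twistedMellin, ← neg_neg w, ← mellin_comp_inv,
      neg_neg]
    rfl
  · have := integral_comp_neg_Ioi 0 g
    rw [neg_zero] at this
    rw [← this, setIntegral_congr_fun measurableSet_Ioi gneg, twistedMellin, ← neg_neg w,
      ← mellin_comp_inv, neg_neg]
    rfl

end

/-! ### Summation over a lattice by rows and by columns -/

lemma e_eq (x : ℝ) : e x = cexp (2 * Real.pi * I * x) := rfl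

lemma norm_e (x : ℝ) : ‖e x‖ = 1 := by
  rw [e_eq, norm_exp]; simp

/-- The change of basis of `ℤ²` that exchanges the two coordinates of the lattice
`{(j, n) : j ≡ an mod c}`: a lattice point is determined by `n` and `k = (j - an)/c`, and by `j` and
`l = (n - bj)/c`, where `b` is the inverse of `a` modulo `c` and `ab + cd = 1`. -/
def latticeEquiv (a b c d : ℤ) (h : a * b + c * d = 1) : ℤ × ℤ ≃ ℤ × ℤ where
  toFun p := (p.2 * c + a * p.1, d * p.1 - b * p.2)
  invFun p := (b * p.1 + c * p.2, d * p.1 - a * p.2)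
  left_inv p := by
    ext
    · simp only; linear_combination p.1 * h
    · simp only; linear_combination p.2 * h
  right_inv p := by
    ext
    · simp only; linear_combination p.1 * h
    · simp only; linear_combination p.2 * h

/-- The summand `|n|^{-1-w} Φ(j/(cn))` at the lattice point `(j, n)`; it vanishes for `n = 0`. -/
noncomputable def latticeTerm (Φ : ℝ → ℂ) (w : ℂ) (c : ℕ) (j n : ℤ) : ℂ :=
  ((|(n : ℝ)| : ℝ) : ℂ) ^ (-1 - w) * Φ (j / (c * n))

lemma latticeTerm_neg (Φ : ℝ → ℂ) (w : ℂ) (c : ℕ) (j n : ℤ) :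
    latticeTerm Φ w c (-j) (-n) = latticeTerm Φ w c j n := by
  simp [latticeTerm, neg_div_neg_eq]

lemma latticeTerm_zero_right (Φ : ℝ → ℂ) {w : ℂ} (hw : 0 < w.re) (c : ℕ) (j : ℤ) :
    latticeTerm Φ w c j 0 = 0 := by
  have : -1 - w ≠ 0 := fun h => by
    have := congrArg re h; simp at this; linarith
  simp [latticeTerm, zero_cpow this]

lemma summable_int_one_div_one_add_sq : Summable fun k : ℤ => 1 / (1 + (k : ℝ) ^ 2) := by
  refine Summable.of_norm_bounded_eventually (Real.summable_abs_int_rpow (b := 2) (by norm_num)) ?_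
  filter_upwards [(finite_singleton (0 : ℤ)).compl_mem_cofinite] with k hk
  have hk : (k : ℝ) ≠ 0 := by exact_mod_cast hk
  have : 0 < (k : ℝ) ^ 2 := by positivity
  rw [Real.norm_of_nonneg (by positivity), Real.rpow_neg (abs_nonneg _), one_div]
  have e1 : |(k : ℝ)| ^ (2 : ℝ) = (k : ℝ) ^ 2 := by
    rw [show (2 : ℝ) = ((2 : ℕ) : ℝ) by norm_num, Real.rpow_natCast, sq_abs]
  rw [e1]
  gcongr
  linarith

lemma summable_latticeTerm (Φ : 𝓢(ℝ, ℂ)) {w : ℂ} (hw : 2 < w.re) (a : ℤ) {c : ℕ} (hc : 0 < c) :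
    Summable fun p : ℤ × ℤ => latticeTerm Φ w c (p.2 * c + a * p.1) p.1 := by
  obtain ⟨C₀, hC₀, h₀⟩ := Φ.decay 0 0
  obtain ⟨C₂, hC₂, h₂⟩ := Φ.decay 2 0
  simp only [norm_iteratedFDeriv_zero, pow_zero, one_mul, Real.norm_eq_abs, sq_abs] at h₀ h₂
  set A : ℝ := a / c
  have hsum := ((Real.summable_abs_int_rpow (b := w.re - 1) (by linarith)).mul_of_nonneg
    summable_int_one_div_one_add_sq (fun n => by positivity)
    (fun k => by positivity)).mul_left ((C₀ + C₂) * (2 + 2 * A ^ 2))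
  refine Summable.of_norm_bounded hsum fun p => ?_
  obtain ⟨n, k⟩ := p
  have hcR : (c : ℝ) ≠ 0 := by exact_mod_cast hc.ne'
  rcases eq_or_ne n 0 with rfl | hn
  · rw [latticeTerm_zero_right _ (by linarith), norm_zero]
    positivity
  have hnR : (n : ℝ) ≠ 0 := by exact_mod_cast hn
  have hn1 : (1 : ℝ) ≤ (n : ℝ) ^ 2 := by
    have : 0 < n ^ 2 := by positivity
    exact_mod_cast Int.add_one_le_of_lt this
  have hn0 : 0 < |(n : ℝ)| := abs_pos.2 hnR
  set u : ℝ := ((k * c + a * n : ℤ) : ℝ) / (c * n) with hu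
  have hk : (k : ℝ) = n * (u - A) := by
    rw [hu]; push_cast; field_simp; simp only [A]; field_simp; ring
  have hΦ : ‖Φ u‖ ≤ (C₀ + C₂) / (1 + u ^ 2) := by
    rw [le_div_iff₀ (by positivity)]
    have := h₀ u; have := h₂ u
    linarith
  have hquad : 1 + (k : ℝ) ^ 2 ≤ (2 + 2 * A ^ 2) * (n : ℝ) ^ 2 * (1 + u ^ 2) := by
    have h1 : (u - A) ^ 2 ≤ 2 * u ^ 2 + 2 * A ^ 2 := by nlinarith [sq_nonneg (u + A)]
    calc 1 + (k : ℝ) ^ 2 ≤ (n : ℝ) ^ 2 + (n : ℝ) ^ 2 * (u - A) ^ 2 := by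
          rw [hk, mul_pow]; linarith
      _ ≤ (n : ℝ) ^ 2 + (n : ℝ) ^ 2 * (2 * u ^ 2 + 2 * A ^ 2) := by gcongr
      _ ≤ (2 + 2 * A ^ 2) * (n : ℝ) ^ 2 * (1 + u ^ 2) := by
          have : 0 ≤ A ^ 2 * (n : ℝ) ^ 2 * u ^ 2 := by positivity
          nlinarith
  have hinv : 1 / (1 + u ^ 2) ≤ (2 + 2 * A ^ 2) * (n : ℝ) ^ 2 * (1 / (1 + (k : ℝ) ^ 2)) := by
    rw [mul_one_div, div_le_div_iff₀ (by positivity) (by positivity)]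
    linarith
  have hnorm : ‖latticeTerm Φ w c (k * c + a * n) n‖ = |(n : ℝ)| ^ (-1 - w.re) * ‖Φ u‖ := by
    rw [latticeTerm, norm_mul, norm_cpow_eq_rpow_re_of_pos hn0, hu]
    simp
  have e1 : |(n : ℝ)| ^ (-(w.re - 1)) = |(n : ℝ)| ^ (-1 - w.re) * (n : ℝ) ^ 2 := by
    rw [← sq_abs (n : ℝ), ← Real.rpow_natCast |(n : ℝ)| 2, ← Real.rpow_add hn0]
    congr 1; push_cast; ring
  rw [hnorm, e1]
  calc _ ≤ |(n : ℝ)| ^ (-1 - w.re) * ((C₀ + C₂) * (1 / (1 + u ^ 2))) := by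
        rw [mul_one_div]; gcongr
    _ ≤ |(n : ℝ)| ^ (-1 - w.re) * ((C₀ + C₂) *
        ((2 + 2 * A ^ 2) * (n : ℝ) ^ 2 * (1 / (1 + (k : ℝ) ^ 2)))) := by gcongr
    _ = _ := by ring

/-- Summation of a Schwartz function over the lattice `{(j, n) : j ≡ an mod c}` by rows and by
columns. -/
lemma tsum_latticeTerm_comm (Φ : 𝓢(ℝ, ℂ)) {w : ℂ} (hw : 2 < w.re) {a b : ℤ} {c : ℕ} (hc : 0 < c)
    (hab : a * b ≡ 1 [ZMOD c]) :
    2 * ∑' n : ℕ+, ∑' k : ℤ, latticeTerm Φ w c (k * c + a * n) n =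
      ∑' l : ℤ, latticeTerm Φ w c 0 (c * l) +
        2 * ∑' j : ℕ+, ∑' l : ℤ, latticeTerm Φ w c j (b * j + c * l) := by
  obtain ⟨d, hd⟩ := hab.dvd
  have hs := summable_latticeTerm Φ hw a hc
  set T := latticeEquiv a b c d (by linear_combination -hd)
  have hcomp : ∀ p : ℤ × ℤ, latticeTerm Φ w c (p.2 * c + a * p.1) p.1 =
      latticeTerm Φ w c (T p).1 (b * (T p).1 + c * (T p).2) := by
    intro p
    have h1 : (T.symm (T p)).1 = p.1 := by rw [T.symm_apply_apply]
    have h2 : (T.symm (T p)).1 = b * (T p).1 + c * (T p).2 := rfl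
    rw [← h2, h1]
    rfl
  have hs' : Summable fun q : ℤ × ℤ => latticeTerm Φ w c q.1 (b * q.1 + c * q.2) :=
    T.summable_iff.1 (by simpa only [Function.comp_def, ← hcomp] using hs)
  have heq : ∑' p : ℤ × ℤ, latticeTerm Φ w c (p.2 * c + a * p.1) p.1 =
      ∑' q : ℤ × ℤ, latticeTerm Φ w c q.1 (b * q.1 + c * q.2) :=
    (tsum_congr hcomp).trans
      (T.tsum_eq fun q : ℤ × ℤ => latticeTerm Φ w c q.1 (b * q.1 + c * q.2))
  rw [hs.tsum_prod, hs'.tsum_prod] at heq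
  have hA0 : ∑' k : ℤ, latticeTerm Φ w c (k * c + a * 0) 0 = 0 := by
    simp [latticeTerm_zero_right Φ (by linarith : 0 < w.re)]
  rw [tsum_int_eq_zero_add_two_mul_tsum_pnat ?_ hs.prod, hA0, zero_add,
    tsum_int_eq_zero_add_two_mul_tsum_pnat ?_ hs'.prod] at heq
  · simpa using heq
  · intro j
    simp only
    rw [← (Equiv.neg ℤ).tsum_eq]
    refine tsum_congr fun l => ?_
    rw [← latticeTerm_neg]
    simp only [Equiv.neg_apply]
    congr 1 <;> ring
  · intro n
    simp only
    rw [← (Equiv.neg ℤ).tsum_eq]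
    refine tsum_congr fun k => ?_
    rw [← latticeTerm_neg]
    simp only [Equiv.neg_apply]
    congr 1 <;> ring

/-! ### The dual transform -/

lemma tsum_pnat_cpow_neg {s : ℂ} (hs : 1 < s.re) :
    ∑' n : ℕ+, ((n : ℕ) : ℂ) ^ (-s) = riemannZeta s := by
  rw [zeta_eq_tsum_one_div_nat_add_one_cpow hs,
    tsum_pnat_eq_tsum_succ (f := fun n : ℕ => (n : ℂ) ^ (-s))]
  refine tsum_congr fun n => ?_
  rw [cpow_neg, one_div]; push_cast; rfl

lemma summable_pnat_cpow_neg {s : ℂ} (hs : 1 < s.re) :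
    Summable fun n : ℕ+ => ((n : ℕ) : ℂ) ^ (-s) := by
  have := (Complex.summable_one_div_nat_cpow.2 hs).comp_injective PNat.coe_injective
  simpa [Function.comp_def, cpow_neg] using this

section

/-- The continuation in `w` of the Fourier transform of `|t|^{-1-w} Φ(1/t)` at `ξ ≠ 0`. It is to be
used with `Ψ(u) = Φ(-u)`: the half line `t < 0` enters through the values of `Ψ` on `(0, ∞)`. -/
noncomputable def dualTransform (Φ Ψ : 𝓢(ℝ, ℂ)) (w : ℂ) (ξ : ℝ) : ℂ :=
  twistedMellinExt Φ ξ w + twistedMellinExt Ψ (-ξ) w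

variable {Φ Ψ : 𝓢(ℝ, ℂ)}

lemma fourier_invDilate_eq_dualTransform (hΨ : ∀ u, Ψ u = Φ (-u)) {w : ℂ} (hw : 0 < w.re) {ξ : ℝ}
    (hξ : ξ ≠ 0) : 𝓕 (invDilate Φ w) ξ = dualTransform Φ Ψ w ξ := by
  rw [fourier_invDilate hΨ hw, dualTransform, twistedMellinExt_eq _ hξ hw,
    twistedMellinExt_eq _ (neg_ne_zero.2 hξ) hw]

lemma fourier_invDilate_zero (hΨ : ∀ u, Ψ u = Φ (-u)) {w : ℂ} (hw : 0 < w.re) :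
    𝓕 (invDilate Φ w) 0 = mellin Φ w + mellin Ψ w := by
  rw [fourier_invDilate hΨ hw]
  simp [twistedMellin]

lemma exists_norm_dualTransform_le (Φ Ψ : 𝓢(ℝ, ℂ)) (K : ℝ) :
    ∃ C : ℝ, 0 ≤ C ∧ ∀ (ξ : ℝ) (w : ℂ), -1 ≤ w.re → ‖w‖ ≤ K →
      ‖dualTransform Φ Ψ w ξ‖ ≤ C / ξ ^ 2 := by
  obtain ⟨C₁, h₁, H₁⟩ := exists_norm_twistedMellinExt_le Φ K
  obtain ⟨C₂, h₂, H₂⟩ := exists_norm_twistedMellinExt_le Ψ K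
  refine ⟨C₁ + C₂, by positivity, fun ξ w hw hK => (norm_add_le _ _).trans ?_⟩
  rw [add_div]
  refine add_le_add (H₁ ξ w hw hK) ?_
  simpa using H₂ (-ξ) w hw hK

lemma summable_pnat_inv_sq : Summable fun m : ℕ+ => 1 / ((m : ℕ) : ℝ) ^ 2 :=
  (Real.summable_one_div_nat_pow.2 one_lt_two).comp_injective PNat.coe_injective

lemma summable_fourier_invDilate (hΨ : ∀ u, Ψ u = Φ (-u)) {w : ℂ} (hw : 0 < w.re) {κ : ℝ}
    (hκ : 0 < κ) : Summable fun m : ℤ => 𝓕 (invDilate Φ w) (m / κ) := by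
  obtain ⟨C, hC, H⟩ := exists_norm_dualTransform_le Φ Ψ ‖w‖
  refine Summable.of_norm_bounded_eventually
    ((Real.summable_one_div_int_pow.2 one_lt_two).mul_left (C * κ ^ 2)) ?_
  filter_upwards [(finite_singleton (0 : ℤ)).compl_mem_cofinite] with m hm
  have hm : (m : ℝ) ≠ 0 := by exact_mod_cast hm
  rw [fourier_invDilate_eq_dualTransform hΨ hw (div_ne_zero hm hκ.ne')]
  refine (H _ w (by linarith) le_rfl).trans (le_of_eq ?_)
  field_simp

/-- Poisson summation along a row of the lattice; it produces the values of `𝓕 Φ` at the positive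
integers. -/
lemma tsum_latticeTerm_row (Φ : 𝓢(ℝ, ℂ)) {B : ℝ} (hB : ∀ x, 𝓕 Φ x ≠ 0 → 0 < x ∧ x ≤ B) (w : ℂ)
    (a c : ℕ) (hc : 0 < c) (n : ℕ+) :
    ∑' k : ℤ, latticeTerm Φ w c (k * c + a * n) n =
      ∑' m : ℕ+, ((n : ℕ) : ℂ) ^ (-w) *
        (𝓕 Φ (((n * m : ℕ+) : ℕ) : ℝ) * e (((n * m : ℕ+) : ℕ) * ((a : ℝ) / c))) := by
  have hn : (0 : ℝ) < (n : ℕ) := by exact_mod_cast n.pos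
  have hnc : ((n : ℕ) : ℂ) ≠ 0 := by exact_mod_cast n.pos.ne'
  have hcR : (c : ℝ) ≠ 0 := by exact_mod_cast hc.ne'
  have hfin : (Function.support fun m : ℤ => 𝓕 (Φ : ℝ → ℂ) (m / ((n : ℕ) : ℝ)⁻¹)).Finite := by
    refine (finite_Icc (0 : ℤ) ⌈B⌉).subset fun m hm => ?_
    have h := hB _ hm
    rw [div_inv_eq_mul] at h
    have h1 : (1 : ℝ) ≤ (n : ℕ) := by exact_mod_cast n.pos
    have hm0 : (0 : ℝ) < m := (mul_pos_iff_of_pos_right hn).1 h.1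
    refine ⟨by exact_mod_cast hm0.le, Int.cast_le.1 (le_trans ?_ (Int.le_ceil B) : (m : ℝ) ≤ _)⟩
    nlinarith [h.2]
  have hP := tsum_dilate_eq_tsum_fourier Φ.continuous one_lt_two
    (Φ.isBigO_cocompact_rpow (-2)) (inv_pos.2 hn) (summable_of_hasFiniteSupport hfin)
    (a * (n : ℕ) / c)
  have hrow : ∀ k : ℤ, latticeTerm Φ w c (k * c + a * n) n =
      ((n : ℕ) : ℂ) ^ (-1 - w) * Φ (((n : ℕ) : ℝ)⁻¹ * (a * (n : ℕ) / c + k)) := by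
    intro k
    rw [latticeTerm]
    congr 2
    · simp
    · push_cast; field_simp; ring
  rw [tsum_congr hrow, tsum_mul_left, hP, ← mul_assoc]
  have hpow : ((n : ℕ) : ℂ) ^ (-1 - w) * (((((n : ℕ) : ℝ)⁻¹ : ℝ) : ℂ))⁻¹ =
      ((n : ℕ) : ℂ) ^ (-w) := by
    rw [show -1 - w = -w - 1 by ring, cpow_sub _ _ hnc, cpow_one]
    push_cast
    field_simp
  rw [hpow, tsum_mul_left]
  congr 1
  have hneg : ∀ m : ℤ, m ≤ 0 → 𝓕 (Φ : ℝ → ℂ) (m / ((n : ℕ) : ℝ)⁻¹) = 0 := by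
    intro m hm
    by_contra h
    have h := (hB _ h).1
    rw [div_inv_eq_mul] at h
    have hm0 : (0 : ℝ) < m := (mul_pos_iff_of_pos_right hn).1 h
    have : (m : ℝ) ≤ 0 := by exact_mod_cast hm
    linarith
  have hsumm : Summable fun m : ℤ => 𝓕 (Φ : ℝ → ℂ) (m / ((n : ℕ) : ℝ)⁻¹) *
      cexp (2 * Real.pi * I * (m * (a * (n : ℕ) / c) : ℝ)) := by
    exact summable_of_hasFiniteSupport (hfin.subset (Function.support_mul_subset_left _ _))
  rw [tsum_int_eq_zero_add_tsum_pnat hsumm, hneg 0 le_rfl]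
  have hz : ∀ m : ℕ+, 𝓕 (Φ : ℝ → ℂ) (((-(m : ℕ) : ℤ) : ℝ) / ((n : ℕ) : ℝ)⁻¹) = 0 := fun m =>
    hneg _ (by simp)
  simp only [hz, zero_mul, tsum_zero, add_zero, zero_add]
  refine tsum_congr fun m => ?_
  rw [e_eq, div_inv_eq_mul, SchwartzMap.fourier_coe]
  push_cast
  congr 2
  · ring_nf
  · ring_nf

/-- Poisson summation along a column `j ≠ 0` of the lattice; the frequency `0` is kept apart, and
the frequencies `±m` give the dual transform. -/
lemma tsum_latticeTerm_column (hΨ : ∀ u, Ψ u = Φ (-u)) {w : ℂ} (hw : 0 < w.re) (b : ℤ) {c : ℕ}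
    (hc : 0 < c) (j : ℕ+) :
    ∑' l : ℤ, latticeTerm Φ w c j (b * j + c * l) =
      (c : ℂ) ^ (w - 1) * (((j : ℕ) : ℂ) ^ (-w) * (mellin Φ w + mellin Ψ w) +
        ∑' m : ℕ+, ((j : ℕ) : ℂ) ^ (-w) *
          (dualTransform Φ Ψ w (((j * m : ℕ+) : ℕ) / (c : ℝ) ^ 2) *
              e (((j * m : ℕ+) : ℕ) * (b : ℝ) / c) +
            dualTransform Φ Ψ w (-(((j * m : ℕ+) : ℕ) / (c : ℝ) ^ 2)) *
              e (-(((j * m : ℕ+) : ℕ) * (b : ℝ) / c)))) := by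
  have hj : (0 : ℝ) < (j : ℕ) := by exact_mod_cast j.pos
  have hjc : ((j : ℕ) : ℂ) ≠ 0 := by exact_mod_cast j.pos.ne'
  have hcR : (0 : ℝ) < c := by exact_mod_cast hc
  have hcc : (c : ℂ) ≠ 0 := by exact_mod_cast hc.ne'
  have hκ : (0 : ℝ) < (c : ℝ) ^ 2 / (j : ℕ) := by positivity
  have hs := summable_fourier_invDilate hΨ hw hκ
  have hP := tsum_dilate_eq_tsum_fourier (continuous_invDilate Φ hw) (b := 1 + w.re) (by linarith)
    (invDilate_isBigO Φ) hκ hs (b * (j : ℕ) / c)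
  have hcol : ∀ l : ℤ, latticeTerm Φ w c j (b * j + c * l) =
      (((j : ℕ) : ℝ) / c : ℝ) ^ (-1 - w) *
        invDilate Φ w ((c : ℝ) ^ 2 / (j : ℕ) * (b * (j : ℕ) / c + l)) := by
    intro l
    have harg : (c : ℝ) ^ 2 / (j : ℕ) * (b * (j : ℕ) / c + l) =
        c / (j : ℕ) * (b * (j : ℕ) + c * l) := by
      field_simp
    rw [harg, latticeTerm, invDilate, ← mul_assoc, ← mul_cpow_ofReal_nonneg (by positivity)
      (abs_nonneg _), ← ofReal_mul, abs_mul, abs_of_pos (by positivity : (0 : ℝ) < c / (j : ℕ))]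
    congr 2
    · push_cast
      field_simp
    · push_cast
      field_simp
  have hsumm : Summable fun m : ℤ => 𝓕 (invDilate Φ w) (m / ((c : ℝ) ^ 2 / (j : ℕ))) *
      cexp (2 * Real.pi * I * (m * (b * (j : ℕ) / c) : ℝ)) := by
    refine Summable.of_norm ?_
    convert hs.norm using 2 with m
    rw [norm_mul, ← e_eq, norm_e, mul_one]
  have hpow : ((((j : ℕ) : ℝ) / c : ℝ) : ℂ) ^ (-1 - w) * (((c : ℝ) ^ 2 / (j : ℕ) : ℝ) : ℂ)⁻¹ =
      (c : ℂ) ^ (w - 1) * ((j : ℕ) : ℂ) ^ (-w) := by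
    have h1 : ((((j : ℕ) : ℝ) / c : ℝ) : ℂ) ^ (-1 - w) =
        ((j : ℕ) : ℂ) ^ (-1 - w) * (c : ℂ) ^ (1 + w) := by
      rw [div_eq_mul_inv, ofReal_mul, mul_cpow_ofReal_nonneg hj.le (by positivity), ofReal_inv,
        inv_cpow _ _ (by rw [arg_ofReal_of_nonneg hcR.le]; exact Real.pi_pos.ne),
        ← cpow_neg]
      push_cast
      ring_nf
    rw [h1, show -1 - w = -w - 1 by ring, cpow_sub _ _ hjc, show 1 + w = w - 1 + (2 : ℕ) by
      push_cast; ring, cpow_add _ _ hcc, cpow_natCast, cpow_one]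
    push_cast
    field_simp
  rw [tsum_congr hcol, tsum_mul_left, hP, ← mul_assoc, hpow, mul_assoc]
  congr 1
  rw [tsum_int_eq_zero_add_tsum_pnat hsumm, tsum_mul_left, ← mul_add]
  congr 1
  have h0 : 𝓕 (invDilate Φ w) (((0 : ℤ) : ℝ) / ((c : ℝ) ^ 2 / (j : ℕ))) *
      cexp (2 * Real.pi * I * (((0 : ℤ) : ℝ) * (b * (j : ℕ) / c) : ℝ)) =
        mellin Φ w + mellin Ψ w := by
    rw [Int.cast_zero, zero_div, fourier_invDilate_zero hΨ hw]
    simp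
  have hpos : ∀ m : ℕ+, 𝓕 (invDilate Φ w) ((((m : ℕ) : ℤ) : ℝ) / ((c : ℝ) ^ 2 / (j : ℕ))) *
      cexp (2 * Real.pi * I * ((((m : ℕ) : ℤ) : ℝ) * (b * (j : ℕ) / c) : ℝ)) =
      dualTransform Φ Ψ w (((j * m : ℕ+) : ℕ) / (c : ℝ) ^ 2) *
        e (((j * m : ℕ+) : ℕ) * (b : ℝ) / c) := by
    intro m
    have hm : (0 : ℝ) < (m : ℕ) := by exact_mod_cast m.pos
    have e1 : (((m : ℕ) : ℤ) : ℝ) / ((c : ℝ) ^ 2 / (j : ℕ)) = ((j * m : ℕ+) : ℕ) / (c : ℝ) ^ 2 := by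
      push_cast; field_simp
    have e2 : (((m : ℕ) : ℤ) : ℝ) * (b * (j : ℕ) / c) = ((j * m : ℕ+) : ℕ) * (b : ℝ) / c := by
      push_cast; ring
    rw [e1, e2, fourier_invDilate_eq_dualTransform hΨ hw (by positivity), e_eq]
  have hneg : ∀ m : ℕ+, 𝓕 (invDilate Φ w) (((-((m : ℕ) : ℤ) : ℤ) : ℝ) / ((c : ℝ) ^ 2 / (j : ℕ))) *
      cexp (2 * Real.pi * I * (((-((m : ℕ) : ℤ) : ℤ) : ℝ) * (b * (j : ℕ) / c) : ℝ)) =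
      dualTransform Φ Ψ w (-(((j * m : ℕ+) : ℕ) / (c : ℝ) ^ 2)) *
        e (-(((j * m : ℕ+) : ℕ) * (b : ℝ) / c)) := by
    intro m
    have hm : (0 : ℝ) < (m : ℕ) := by exact_mod_cast m.pos
    have e1 : ((-((m : ℕ) : ℤ) : ℤ) : ℝ) / ((c : ℝ) ^ 2 / (j : ℕ)) =
        -(((j * m : ℕ+) : ℕ) / (c : ℝ) ^ 2) := by
      push_cast; field_simp
    have e2 : ((-((m : ℕ) : ℤ) : ℤ) : ℝ) * (b * (j : ℕ) / c) =
        -(((j * m : ℕ+) : ℕ) * (b : ℝ) / c) := by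
      push_cast; ring
    rw [e1, e2, fourier_invDilate_eq_dualTransform hΨ hw (neg_ne_zero.2 (by positivity)), e_eq]
  have hinj : Function.Injective fun m : ℕ+ => ((m : ℕ) : ℤ) := fun x y h =>
    PNat.coe_injective (by simpa using h)
  have spos := hsumm.comp_injective hinj
  have sneg := hsumm.comp_injective (neg_injective.comp hinj)
  rw [h0, add_assoc]
  congr 1
  refine (spos.tsum_add sneg).symm.trans (tsum_congr fun m => ?_)
  rw [← hpos, ← hneg]
  rfl

end

/-! ### The formula in the region of absolute convergence -/

/-- The contribution to the dual side of the pair `(j, m)` of positive integers, at the frequency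
`εjm/c²` with a sign `ε`. -/
noncomputable def dualPart (Φ Ψ : 𝓢(ℝ, ℂ)) (b : ℤ) (c : ℕ) (ε : ℝ) (w : ℂ) (p : ℕ+ × ℕ+) : ℂ :=
  ((p.1 : ℕ) : ℂ) ^ (-w) *
    (dualTransform Φ Ψ w (ε * (((p.1 * p.2 : ℕ+) : ℕ) / (c : ℝ) ^ 2)) *
      e (ε * (((p.1 * p.2 : ℕ+) : ℕ) * (b : ℝ) / c)))

lemma summable_pnat_prod :
    Summable fun p : ℕ+ × ℕ+ => ((p.1 : ℕ) : ℝ) ^ (-(3 / 2) : ℝ) * (1 / ((p.2 : ℕ) : ℝ) ^ 2) := by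
  have h1 : Summable fun m : ℕ+ => ((m : ℕ) : ℝ) ^ (-(3 / 2) : ℝ) :=
    (Real.summable_nat_rpow.2 (by norm_num)).comp_injective PNat.coe_injective
  exact h1.mul_of_nonneg summable_pnat_inv_sq (fun n => by positivity) (fun n => by positivity)

lemma exists_norm_dualPart_le (Φ Ψ : 𝓢(ℝ, ℂ)) (b : ℤ) {c : ℕ} (hc : 0 < c) (K : ℝ) :
    ∃ C : ℝ, ∀ (ε : ℝ) (w : ℂ) (p : ℕ+ × ℕ+), |ε| = 1 → -1 / 2 ≤ w.re → ‖w‖ ≤ K →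
      ‖dualPart Φ Ψ b c ε w p‖ ≤
        C * (((p.1 : ℕ) : ℝ) ^ (-(3 / 2) : ℝ) * (1 / ((p.2 : ℕ) : ℝ) ^ 2)) := by
  obtain ⟨C, hC, H⟩ := exists_norm_dualTransform_le Φ Ψ K
  refine ⟨C * (c : ℝ) ^ 4, fun ε w p hε hw hK => ?_⟩
  have hcR : (0 : ℝ) < c := by exact_mod_cast hc
  have h1 : (0 : ℝ) < (p.1 : ℕ) := by exact_mod_cast p.1.pos
  have h2 : (0 : ℝ) < (p.2 : ℕ) := by exact_mod_cast p.2.pos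
  have h1' : (1 : ℝ) ≤ (p.1 : ℕ) := by exact_mod_cast p.1.pos
  rw [dualPart, norm_mul, norm_mul, norm_e, mul_one]
  have n1 : ‖((p.1 : ℕ) : ℂ) ^ (-w)‖ ≤ ((p.1 : ℕ) : ℝ) ^ (1 / 2 : ℝ) := by
    rw [norm_natCast_cpow_of_pos p.1.pos]
    exact Real.rpow_le_rpow_of_exponent_le h1' (by simp; linarith)
  have n2 := H (ε * (((p.1 * p.2 : ℕ+) : ℕ) / (c : ℝ) ^ 2)) w (by linarith) hK
  calc _ ≤ ((p.1 : ℕ) : ℝ) ^ (1 / 2 : ℝ) *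
        (C / (ε * (((p.1 * p.2 : ℕ+) : ℕ) / (c : ℝ) ^ 2)) ^ 2) := by gcongr
    _ = _ := by
        have e1 : ((p.1 : ℕ) : ℝ) ^ (1 / 2 : ℝ) =
            ((p.1 : ℕ) : ℝ) ^ (-(3 / 2) : ℝ) * ((p.1 : ℕ) : ℝ) ^ 2 := by
          rw [← Real.rpow_natCast ((p.1 : ℕ) : ℝ) 2, ← Real.rpow_add h1]
          norm_num
        rw [e1, mul_pow, ← sq_abs ε, hε, PNat.mul_coe, Nat.cast_mul]
        field_simp

lemma summable_dualPart (Φ Ψ : 𝓢(ℝ, ℂ)) (b : ℤ) {c : ℕ} (hc : 0 < c) {ε : ℝ} (hε : |ε| = 1)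
    {w : ℂ} (hw : -1 / 2 ≤ w.re) : Summable (dualPart Φ Ψ b c ε w) := by
  obtain ⟨C, H⟩ := exists_norm_dualPart_le Φ Ψ b hc ‖w‖
  exact Summable.of_norm_bounded (summable_pnat_prod.mul_left C) fun p => H ε w p hε hw le_rfl

lemma differentiableOn_tsum_dualPart (Φ Ψ : 𝓢(ℝ, ℂ)) (b : ℤ) {c : ℕ} (hc : 0 < c) {ε : ℝ}
    (hε : |ε| = 1) {U : Set ℂ} (hU : IsOpen U) {K : ℝ} (hUK : ∀ w ∈ U, -1 / 2 ≤ w.re ∧ ‖w‖ ≤ K) :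
    DifferentiableOn ℂ (fun w => ∑' p, dualPart Φ Ψ b c ε w p) U := by
  obtain ⟨C, H⟩ := exists_norm_dualPart_le Φ Ψ b hc K
  refine differentiableOn_tsum_of_summable_norm (summable_pnat_prod.mul_left C) (fun p w hw => ?_)
    hU (fun p w hw => H ε w p hε (hUK w hw).1 (hUK w hw).2)
  have hre : -2 < w.re := by linarith [(hUK w hw).1]
  have h0 : ((p.1 : ℕ) : ℂ) ≠ 0 := by exact_mod_cast p.1.pos.ne'
  have d1 := differentiableAt_twistedMellinExt Φ (ε * (((p.1 * p.2 : ℕ+) : ℕ) / (c : ℝ) ^ 2)) hre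
  have d2 := differentiableAt_twistedMellinExt Ψ (-(ε * (((p.1 * p.2 : ℕ+) : ℕ) / (c : ℝ) ^ 2))) hre
  have d3 : DifferentiableAt ℂ (fun w : ℂ => ((p.1 : ℕ) : ℂ) ^ (-w)) w :=
    (differentiableAt_id.neg).const_cpow (Or.inl h0)
  unfold dualPart dualTransform
  exact (d3.mul ((d1.add d2).mul_const _)).differentiableWithinAt

lemma finite_setOf_mul_ne_zero {G : ℝ → ℂ} {B : ℝ} (hB : ∀ x, G x ≠ 0 → x ≤ B) :
    {p : ℕ+ × ℕ+ | G (((p.1 * p.2 : ℕ+) : ℕ) : ℝ) ≠ 0}.Finite := by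
  refine (((finite_Iic ⌈B⌉₊.succPNat).prod (finite_Iic ⌈B⌉₊.succPNat)).subset fun p hp => ?_)
  have h1 : (((p.1 * p.2 : ℕ+) : ℕ) : ℝ) ≤ (⌈B⌉₊ : ℝ) := (hB _ hp).trans (Nat.le_ceil B)
  have h2 : (p.1 : ℕ) * p.2 ≤ ⌈B⌉₊ := by exact_mod_cast h1
  have h3 := p.1.pos
  have h4 := p.2.pos
  constructor <;>
  · refine PNat.coe_le_coe _ _ |>.1 ?_
    rw [Nat.succPNat_coe]
    nlinarith

/-- The summation formula in its region of absolute convergence. -/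
lemma tsum_eq_dual_of_two_lt_re {Φ Ψ : 𝓢(ℝ, ℂ)} (hΨ : ∀ u, Ψ u = Φ (-u)) {B : ℝ}
    (hB : ∀ x, 𝓕 Φ x ≠ 0 → 0 < x ∧ x ≤ B) {w : ℂ} (hw : 2 < w.re) {a c : ℕ} {b : ℤ} (hc : 0 < c)
    (hab : (a : ℤ) * b ≡ 1 [ZMOD c]) :
    ∑' p : ℕ+ × ℕ+, ((p.1 : ℕ) : ℂ) ^ (-w) *
        (𝓕 Φ (((p.1 * p.2 : ℕ+) : ℕ) : ℝ) * e (((p.1 * p.2 : ℕ+) : ℕ) * ((a : ℝ) / c))) =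
      (c : ℂ) ^ (-1 - w) * (riemannZeta (1 + w) * Φ 0) +
        (c : ℂ) ^ (w - 1) * (riemannZeta w * (mellin Φ w + mellin Ψ w) +
          (∑' p, dualPart Φ Ψ b c 1 w p + ∑' p, dualPart Φ Ψ b c (-1) w p)) := by
  have hcc : (c : ℂ) ≠ 0 := by exact_mod_cast hc.ne'
  have hcR : (c : ℝ) ≠ 0 := by exact_mod_cast hc.ne'
  have hw0 : 0 < w.re := by linarith
  have hcomm := tsum_latticeTerm_comm Φ hw hc hab
  -- the rows
  have hfin : Summable fun p : ℕ+ × ℕ+ => ((p.1 : ℕ) : ℂ) ^ (-w) *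
      (𝓕 Φ (((p.1 * p.2 : ℕ+) : ℕ) : ℝ) * e (((p.1 * p.2 : ℕ+) : ℕ) * ((a : ℝ) / c))) := by
    refine summable_of_hasFiniteSupport ((finite_setOf_mul_ne_zero
      (G := (𝓕 Φ : 𝓢(ℝ, ℂ)))
      (fun x hx => (hB x hx).2)).subset fun p hp h0 => hp ?_)
    simp only [h0, zero_mul, mul_zero]
  have hrows : ∑' n : ℕ+, ∑' k : ℤ, latticeTerm Φ w c (k * c + a * n) n =
      ∑' p : ℕ+ × ℕ+, ((p.1 : ℕ) : ℂ) ^ (-w) *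
        (𝓕 Φ (((p.1 * p.2 : ℕ+) : ℕ) : ℝ) * e (((p.1 * p.2 : ℕ+) : ℕ) * ((a : ℝ) / c))) := by
    rw [hfin.tsum_prod]
    exact tsum_congr fun n => tsum_latticeTerm_row Φ hB w a c hc n
  -- the column `j = 0`
  have hzero : ∑' l : ℤ, latticeTerm Φ w c 0 (c * l) =
      2 * ((c : ℂ) ^ (-1 - w) * (riemannZeta (1 + w) * Φ 0)) := by
    have hterm : ∀ l : ℤ, latticeTerm Φ w c 0 (c * l) =
        (c : ℂ) ^ (-1 - w) * Φ 0 * ((|(l : ℝ)| : ℝ) : ℂ) ^ (-1 - w) := by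
      intro l
      rw [latticeTerm]
      push_cast
      rw [abs_mul, Nat.abs_cast, ofReal_mul, mul_cpow_ofReal_nonneg (by positivity) (abs_nonneg _)]
      simp only [zero_div, ofReal_natCast]
      ring
    have hne : -1 - w ≠ 0 := fun h => by
      have := congrArg re h; simp at this; linarith
    have hs : Summable fun l : ℤ => ((|(l : ℝ)| : ℝ) : ℂ) ^ (-1 - w) := by
      refine Summable.of_norm_bounded (Real.summable_abs_int_rpow (b := 1 + w.re) (by linarith))
        fun l => ?_
      rcases eq_or_ne l 0 with rfl | hl
      · simp [zero_cpow hne]; positivity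
      · have : 0 < |(l : ℝ)| := abs_pos.2 (by exact_mod_cast hl)
        rw [norm_cpow_eq_rpow_re_of_pos this]
        apply le_of_eq
        congr 1
        simp; ring
    rw [tsum_congr hterm, tsum_mul_left, tsum_int_eq_zero_add_two_mul_tsum_pnat (by
      intro l; simp) hs]
    have hz := tsum_pnat_cpow_neg (s := 1 + w) (by simp; linarith)
    rw [neg_add'] at hz
    simp only [Int.cast_zero, abs_zero, ofReal_zero, zero_cpow hne, zero_add, Int.cast_natCast,
      Nat.abs_cast, ofReal_natCast, hz, nsmul_eq_mul]
    push_cast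
    ring
  -- the columns `j ≠ 0`
  have s1 := summable_dualPart Φ Ψ b hc (ε := 1) (by simp) (w := w) (by linarith)
  have s2 := summable_dualPart Φ Ψ b hc (ε := -1) (by simp) (w := w) (by linarith)
  have s12 := s1.add s2
  have hcol : ∀ j : ℕ+, ∑' l : ℤ, latticeTerm Φ w c j (b * j + c * l) =
      (c : ℂ) ^ (w - 1) * (((j : ℕ) : ℂ) ^ (-w) * (mellin Φ w + mellin Ψ w) +
        ∑' m : ℕ+, (dualPart Φ Ψ b c 1 w (j, m) + dualPart Φ Ψ b c (-1) w (j, m))) := by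
    intro j
    rw [tsum_latticeTerm_column hΨ hw0 b hc j]
    simp only [dualPart, one_mul, neg_one_mul, mul_add]
  have hcols : ∑' j : ℕ+, ∑' l : ℤ, latticeTerm Φ w c j (b * j + c * l) =
      (c : ℂ) ^ (w - 1) * (riemannZeta w * (mellin Φ w + mellin Ψ w) +
          (∑' p, dualPart Φ Ψ b c 1 w p + ∑' p, dualPart Φ Ψ b c (-1) w p)) := by
    rw [tsum_congr hcol, tsum_mul_left, ((summable_pnat_cpow_neg
      (by linarith : 1 < w.re)).mul_right _).tsum_add s12.prod, tsum_mul_right,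
      tsum_pnat_cpow_neg (by linarith), ← s1.tsum_add s2, s12.tsum_prod]
  rw [hrows, hzero, hcols] at hcomm
  linear_combination hcomm / 2

/-! ### Analytic continuation -/

lemma fourierInv_eq_integral (G : 𝓢(ℝ, ℂ)) (u : ℝ) :
    𝓕⁻ G u = ∫ x, G x * cexp (2 * Real.pi * I * (1 : ℝ) * x * u) := by
  rw [SchwartzMap.fourierInv_coe, Real.fourierInv_eq']
  refine integral_congr_ae (Eventually.of_forall fun x => ?_)
  simp only [smul_eq_mul, RCLike.inner_apply, conj_trivial]
  rw [mul_comm]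
  congr 2
  push_cast
  ring

lemma fourier_eq_integral (G : 𝓢(ℝ, ℂ)) (u : ℝ) :
    𝓕 G u = ∫ x, G x * cexp (2 * Real.pi * I * (-1 : ℝ) * x * u) := by
  rw [SchwartzMap.fourier_coe, Real.fourier_real_eq_integral_exp_smul]
  refine integral_congr_ae (Eventually.of_forall fun x => ?_)
  simp only [smul_eq_mul]
  rw [mul_comm]
  congr 2
  push_cast
  ring

lemma fourier_eq_fourierInv_neg (G : 𝓢(ℝ, ℂ)) (u : ℝ) : 𝓕 G u = 𝓕⁻ G (-u) := by
  rw [fourier_eq_integral, fourierInv_eq_integral]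
  refine integral_congr_ae (Eventually.of_forall fun x => ?_)
  push_cast
  ring_nf

lemma exists_support_subset_Icc {G : 𝓢(ℝ, ℂ)} (hGc : HasCompactSupport G)
    (hG0 : tsupport G ⊆ Ioi 0) : ∃ A B : ℝ, 0 < A ∧ tsupport G ⊆ Icc A B := by
  rcases (tsupport G).eq_empty_or_nonempty with h | h
  · exact ⟨1, 1, one_pos, by simp [h]⟩
  · obtain ⟨A, hA⟩ := hGc.exists_isLeast h
    obtain ⟨B, hB⟩ := hGc.exists_isGreatest h
    exact ⟨A, B, hG0 hA.1, fun x hx => ⟨hA.2 hx, hB.2 hx⟩⟩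

lemma eq_zero_of_nonpos {G : 𝓢(ℝ, ℂ)} (hG0 : tsupport G ⊆ Ioi 0) {x : ℝ} (hx : x ≤ 0) : G x = 0 :=
  image_eq_zero_of_notMem_tsupport fun h => absurd (hG0 h) (not_lt.2 hx)

lemma integral_eq_setIntegral_Ioi {G : 𝓢(ℝ, ℂ)} (hG0 : tsupport G ⊆ Ioi 0)
    (k : ℝ → ℂ) :
    ∫ x, G x * k x = ∫ x in Ioi (0 : ℝ), G x * k x := by
  rw [setIntegral_eq_integral_of_forall_compl_eq_zero]
  intro x hx
  rw [eq_zero_of_nonpos hG0 (not_lt.1 hx), zero_mul]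

lemma differentiable_integral_cpow {G : 𝓢(ℝ, ℂ)} (hGc : HasCompactSupport G)
    (hG0 : tsupport G ⊆ Ioi 0) :
    Differentiable ℂ fun w : ℂ => ∫ x, G x * (x : ℂ) ^ (-w) := by
  obtain ⟨A, B, hA, hAB⟩ := exists_support_subset_Icc hGc hG0
  have hG : ∀ x, x ∉ Icc A B → G x = 0 := fun x hx =>
    image_eq_zero_of_notMem_tsupport fun h => hx (hAB h)
  have h1 : ∀ s : ℂ, DifferentiableAt ℂ (mellin G) s := by
    intro s
    refine mellin_differentiableAt_of_isBigO_rpow (a := s.re + 1) (b := s.re - 1)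
      (G.continuous.continuousOn.locallyIntegrableOn measurableSet_Ioi) ?_ (by linarith) ?_
      (by linarith)
    · refine (Asymptotics.isBigO_zero _ _).congr' ?_ EventuallyEq.rfl
      filter_upwards [eventually_gt_atTop B] with x hx
      exact (hG x fun h => absurd h.2 (not_le.2 hx)).symm
    · refine (Asymptotics.isBigO_zero _ _).congr' ?_ EventuallyEq.rfl
      filter_upwards [nhdsWithin_le_nhds (gt_mem_nhds hA)] with x hx
      exact (hG x fun h => absurd h.1 (not_le.2 hx)).symm
  have h2 : (fun w : ℂ => ∫ x, G x * (x : ℂ) ^ (-w)) = fun w => mellin G (1 - w) := by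
    ext w
    rw [integral_eq_setIntegral_Ioi hG0, mellin]
    refine setIntegral_congr_fun measurableSet_Ioi fun x _ => ?_
    simp only [smul_eq_mul]
    rw [mul_comm, show (1 : ℂ) - w - 1 = -w by ring]
  rw [h2]
  exact fun w => (h1 (1 - w)).comp w (by fun_prop)

/-- For `x > 0` the values of `z^w` at `∓2πix` add up to `2 cos(πw/2) (2πx)^w`. -/
lemma cpow_add_cpow_neg {x : ℝ} (hx : 0 < x) (w : ℂ) :
    (-(2 * Real.pi * I * (1 : ℝ) * x)) ^ w + (-(2 * Real.pi * I * (-1 : ℝ) * x)) ^ w =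
      2 * Complex.cos (Real.pi * w / 2) * (2 * Real.pi * x : ℝ) ^ w := by
  have hpos : 0 < 2 * Real.pi * x := by positivity
  have e1 : -(2 * Real.pi * I * (1 : ℝ) * x) = ((2 * Real.pi * x : ℝ) : ℂ) * -I := by
    push_cast; ring
  have e2 : -(2 * Real.pi * I * (-1 : ℝ) * x) = ((2 * Real.pi * x : ℝ) : ℂ) * I := by
    push_cast; ring
  have hne : ((2 * Real.pi * x : ℝ) : ℂ) ≠ 0 := by exact_mod_cast hpos.ne'
  rw [e1, e2, cpow_def_of_ne_zero (mul_ne_zero hne (neg_ne_zero.2 I_ne_zero)),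
    cpow_def_of_ne_zero (mul_ne_zero hne I_ne_zero), cpow_def_of_ne_zero hne,
    log_ofReal_mul hpos (neg_ne_zero.2 I_ne_zero), log_ofReal_mul hpos I_ne_zero, log_neg_I, log_I,
    ofReal_log hpos.le, Complex.cos, add_mul, add_mul, Complex.exp_add, Complex.exp_add]
  rw [show -(Real.pi / 2 : ℂ) * I * w = -(Real.pi * w / 2) * I by ring,
    show (Real.pi / 2 : ℂ) * I * w = Real.pi * w / 2 * I by ring]
  ring

/-- The functional equation of `ζ` turns the zero frequency of the dual side into the second polar
term. -/
lemma riemannZeta_mul_mellin_add {G : 𝓢(ℝ, ℂ)} (hGc : HasCompactSupport G)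
    (hG0 : tsupport G ⊆ Ioi 0) {w : ℂ} (hw : 0 < w.re) (hw1 : w ≠ 1) :
    riemannZeta w * (mellin (𝓕⁻ G : 𝓢(ℝ, ℂ)) w + mellin (𝓕 G : 𝓢(ℝ, ℂ)) w) =
      riemannZeta (1 - w) * ∫ x, G x * (x : ℂ) ^ (-w) := by
  have hint : ∀ σ : ℝ, σ ≠ 0 → Integrable fun x : ℝ =>
      G x * (-(2 * Real.pi * I * σ * x)) ^ (-w) := by
    intro σ hσ
    have hcont : Continuous fun x : ℝ => G x * (-(2 * Real.pi * I * σ * x)) ^ (-w) := by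
      refine continuous_iff_continuousAt.2 fun x => ?_
      by_cases hx : x ∈ tsupport G
      · refine G.continuous.continuousAt.mul
          (ContinuousAt.cpow (by fun_prop) continuousAt_const (Or.inr ?_))
        exact im_two_pi_I_mul_ne_zero hσ (hG0 hx).ne'
      · refine (continuousAt_const (y := (0 : ℂ))).congr ?_
        filter_upwards [(isClosed_tsupport G).isOpen_compl.mem_nhds hx] with y hy
        rw [image_eq_zero_of_notMem_tsupport hy, zero_mul]
    exact hcont.integrable_of_hasCompactSupport hGc.mul_right
  have m1 := mellin_fourier G.continuous hGc hG0 one_ne_zero hw (fourierInv_eq_integral G)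
    (mellinConvergent_schwartz _ hw)
  have m2 := mellin_fourier G.continuous hGc hG0 (neg_ne_zero.2 one_ne_zero) hw
    (fourier_eq_integral G) (mellinConvergent_schwartz _ hw)
  have hneg : ∀ n : ℕ, w ≠ -n := fun n h => by
    have : (0 : ℝ) ≤ n := n.cast_nonneg
    rw [h] at hw; simp at hw; linarith
  rw [m1, m2, riemannZeta_one_sub hneg hw1, ← mul_add,
    ← integral_add (hint 1 one_ne_zero) (hint (-1) (neg_ne_zero.2 one_ne_zero))]
  have hsum : ∫ x, (G x * (-(2 * Real.pi * I * (1 : ℝ) * x)) ^ (-w) +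
      G x * (-(2 * Real.pi * I * (-1 : ℝ) * x)) ^ (-w)) =
      2 * (2 * Real.pi : ℂ) ^ (-w) * Complex.cos (Real.pi * w / 2) * ∫ x, G x * (x : ℂ) ^ (-w) := by
    rw [← integral_const_mul]
    refine integral_congr_ae (Eventually.of_forall fun x => ?_)
    simp only
    rcases le_or_gt x 0 with hx | hx
    · simp [eq_zero_of_nonpos hG0 hx]
    · rw [← mul_add, cpow_add_cpow_neg hx, ofReal_mul, mul_cpow_ofReal_nonneg (by positivity) hx.le,
        show (Real.pi * -w / 2 : ℂ) = -(Real.pi * w / 2) by ring, Complex.cos_neg]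
      push_cast
      ring
  rw [hsum]
  ring

/-- The summation formula on the critical line `w = 2ir`, by analytic continuation from the region
of absolute convergence. -/
theorem tsum_eq_dual {G : 𝓢(ℝ, ℂ)} (hGc : HasCompactSupport G)
    (hG0 : tsupport G ⊆ Ioi 0) {r : ℝ} (hr : r ≠ 0) {a c : ℕ} {b : ℤ} (hc : 0 < c)
    (hab : (a : ℤ) * b ≡ 1 [ZMOD c]) :
    ∑' p : ℕ+ × ℕ+, ((p.1 : ℕ) : ℂ) ^ (-(2 * I * r)) *
        (G (((p.1 * p.2 : ℕ+) : ℕ) : ℝ) * e (((p.1 * p.2 : ℕ+) : ℕ) * ((a : ℝ) / c))) =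
      (c : ℂ) ^ (-1 - 2 * I * r) * (riemannZeta (1 + 2 * I * r) * ∫ x, G x) +
        (c : ℂ) ^ (2 * I * r - 1) *
          ((riemannZeta (1 - 2 * I * r) * ∫ x, G x * (x : ℂ) ^ (-(2 * I * r))) +
            (∑' p, dualPart (𝓕⁻ G) (𝓕 G) b c 1 (2 * I * r) p +
              ∑' p, dualPart (𝓕⁻ G) (𝓕 G) b c (-1) (2 * I * r) p)) := by
  have hcc : (c : ℂ) ≠ 0 := by exact_mod_cast hc.ne'
  obtain ⟨A, B, hA, hAB⟩ := exists_support_subset_Icc hGc hG0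
  have hAB' : ∀ x, G x ≠ 0 → 0 < x ∧ x ≤ B := fun x hx => by
    have h := hAB (subset_tsupport _ hx)
    exact ⟨hA.trans_le h.1, h.2⟩
  have hB : ∀ x, G x ≠ 0 → x ≤ B := fun x hx => (hAB' x hx).2
  -- `U` is connected, avoids the poles of `ζ(1 ± w)` at `w = 0`, and contains both `2ir` and the
  -- point `3 + 2ir` of the region of absolute convergence.
  set K : ℝ := 2 * |r| + 4
  set U : Set ℂ := {w | 0 < r * w.im ∧ -1 / 2 < w.re ∧ ‖w‖ < K} with hUdef
  have hUo : IsOpen U :=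
    (isOpen_lt continuous_const (continuous_const.mul continuous_im)).inter
      ((isOpen_lt continuous_const continuous_re).inter
        (isOpen_lt continuous_norm continuous_const))
  have hUc : Convex ℝ U := by
    have h1 : Convex ℝ {w : ℂ | 0 < r * w.im} := by
      have := (convex_Ioi (0 : ℝ)).linear_preimage (r • imLm)
      exact this
    have h2 : Convex ℝ {w : ℂ | ‖w‖ < K} := by
      have := convex_ball (0 : ℂ) K
      rwa [show Metric.ball (0 : ℂ) K = {w : ℂ | ‖w‖ < K} by ext; simp] at this
    exact h1.inter ((convex_halfSpace_re_gt _).inter h2)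
  have hUim : ∀ w ∈ U, w.im ≠ 0 := fun w hw h => by
    have := hw.1; rw [h, mul_zero] at this; exact lt_irrefl _ this
  set Lhs : ℂ → ℂ := fun w => ∑' p : ℕ+ × ℕ+, ((p.1 : ℕ) : ℂ) ^ (-w) *
        (G (((p.1 * p.2 : ℕ+) : ℕ) : ℝ) * e (((p.1 * p.2 : ℕ+) : ℕ) * ((a : ℝ) / c))) with hL
  set Rhs : ℂ → ℂ := fun w => (c : ℂ) ^ (-1 - w) * (riemannZeta (1 + w) * ∫ x, G x) +
        (c : ℂ) ^ (w - 1) *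
          ((riemannZeta (1 - w) * ∫ x, G x * (x : ℂ) ^ (-w)) +
            (∑' p, dualPart (𝓕⁻ G) (𝓕 G) b c 1 w p +
              ∑' p, dualPart (𝓕⁻ G) (𝓕 G) b c (-1) w p)) with hR
  have hLd : DifferentiableOn ℂ Lhs U := by
    have hfin := finite_setOf_mul_ne_zero hB
    have : Lhs = fun w => ∑ p ∈ hfin.toFinset, ((p.1 : ℕ) : ℂ) ^ (-w) *
        (G (((p.1 * p.2 : ℕ+) : ℕ) : ℝ) * e (((p.1 * p.2 : ℕ+) : ℕ) * ((a : ℝ) / c))) := by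
      ext w
      refine tsum_eq_sum fun p hp => ?_
      have h0 : G (((p.1 * p.2 : ℕ+) : ℕ) : ℝ) = 0 := by simpa using hp
      rw [h0, zero_mul, mul_zero]
    rw [this]
    refine DifferentiableOn.fun_sum fun p _ => DifferentiableOn.mul_const ?_ _
    have h0 : ((p.1 : ℕ) : ℂ) ≠ 0 := by exact_mod_cast p.1.pos.ne'
    exact fun w _ => (differentiableAt_id.neg.const_cpow (Or.inl h0)).differentiableWithinAt
  have hRd : DifferentiableOn ℂ Rhs U := by
    have hUK : ∀ w ∈ U, -1 / 2 ≤ w.re ∧ ‖w‖ ≤ K := fun w hw => ⟨hw.2.1.le, hw.2.2.le⟩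
    have d1 := differentiableOn_tsum_dualPart (𝓕⁻ G) (𝓕 G) b hc (ε := 1) (by simp) hUo hUK
    have d2 := differentiableOn_tsum_dualPart (𝓕⁻ G) (𝓕 G) b hc (ε := -1) (by simp) hUo hUK
    have d3 : DifferentiableOn ℂ (fun w => riemannZeta (1 + w)) U := fun w hw =>
      ((differentiableAt_riemannZeta (s := 1 + w) fun h => hUim w hw (by
        have := congrArg im h; simpa using this)).comp w (by fun_prop)).differentiableWithinAt
    have d4 : DifferentiableOn ℂ (fun w => riemannZeta (1 - w)) U := fun w hw =>
      ((differentiableAt_riemannZeta (s := 1 - w) fun h => hUim w hw (by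
        have := congrArg im h; simpa using this)).comp w (by fun_prop)).differentiableWithinAt
    have d5 : DifferentiableOn ℂ (fun w => (c : ℂ) ^ (-1 - w)) U := fun w _ =>
      (DifferentiableAt.const_cpow (by fun_prop) (Or.inl hcc)).differentiableWithinAt
    have d6 : DifferentiableOn ℂ (fun w => (c : ℂ) ^ (w - 1)) U := fun w _ =>
      (DifferentiableAt.const_cpow (by fun_prop) (Or.inl hcc)).differentiableWithinAt
    exact (d5.mul (d3.mul_const _)).add (d6.mul ((d4.mul
      (differentiable_integral_cpow hGc hG0).differentiableOn).add (d1.add d2)))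
  have hΦ0 : (𝓕⁻ G : 𝓢(ℝ, ℂ)) 0 = ∫ x, G x := by
    rw [fourierInv_eq_integral]; simp
  have hFF : (𝓕 (𝓕⁻ G : 𝓢(ℝ, ℂ)) : 𝓢(ℝ, ℂ)) = G := FourierTransform.fourier_fourierInv_eq G
  have key : ∀ w ∈ U, 2 < w.re → Lhs w = Rhs w := by
    intro w hw hre
    have h := tsum_eq_dual_of_two_lt_re (Φ := 𝓕⁻ G) (Ψ := 𝓕 G) (fourier_eq_fourierInv_neg G)
      (B := B) (by rw [hFF]; exact hAB') hre hc hab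
    rw [hFF, hΦ0, riemannZeta_mul_mellin_add hGc hG0 (by linarith)
      (fun h => by rw [h] at hre; norm_num at hre)] at h
    exact h
  have hr2 : 0 < r * r := mul_self_pos.2 hr
  have hz1 : (3 + 2 * I * r : ℂ) ∈ U := by
    refine ⟨by simp; linarith, by simp; norm_num, ?_⟩
    refine (norm_add_le _ _).trans_lt ?_
    simp [K]; linarith
  have hz0 : (2 * I * r : ℂ) ∈ U := by
    refine ⟨by simp; linarith, by simp; norm_num, ?_⟩
    simp [K]
  have heq := (hLd.analyticOnNhd hUo).eqOn_of_preconnected_of_eventuallyEq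
    (hRd.analyticOnNhd hUo) hUc.isPreconnected hz1 (by
      filter_upwards [hUo.mem_nhds hz1, (isOpen_lt continuous_const continuous_re).mem_nhds
        (show (2 : ℝ) < (3 + 2 * I * r : ℂ).re by simp; norm_num)] with w h1 h2
      exact key w h1 h2)
  exact heq hz0

/-! ### The dual transform as a Bessel transform -/

/-- The factor `2π cos(πw/2) / sin(πw)`, by which `J_{-w} - J_w` and `I_{-w} - I_w` have to be
multiplied to give the kernels `J_r^+` and `J_r^-` for `w = 2ir`. -/
noncomputable def kernelFactor (w : ℂ) : ℂ :=
  2 * Real.pi * Complex.cos (Real.pi * w / 2) / Complex.sin (Real.pi * w)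

lemma cpow_add_cpow_neg_abs {ξ : ℝ} (hξ : ξ ≠ 0) (w : ℂ) :
    (2 * Real.pi * I * (1 : ℝ) * ξ) ^ w + (2 * Real.pi * I * (-1 : ℝ) * ξ) ^ w =
      2 * Complex.cos (Real.pi * w / 2) * (2 * Real.pi * |ξ| : ℝ) ^ w := by
  have h := cpow_add_cpow_neg (abs_pos.2 hξ) w
  rw [← h]
  rcases abs_choice ξ with h0 | h0 <;> rw [h0]
  · rw [add_comm]
    congr 2 <;> · push_cast; ring
  · congr 2 <;> · push_cast; ring

lemma dualTransform_eq_of_re_pos {G : 𝓢(ℝ, ℂ)} (hGc : HasCompactSupport G)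
    (hG0 : tsupport G ⊆ Ioi 0) {ξ : ℝ} (hξ : ξ ≠ 0) {w : ℂ} (hw0 : 0 < w.re) (hw1 : w.re < 1) :
    dualTransform (𝓕⁻ G) (𝓕 G) w ξ = kernelFactor w * ∫ x, G x *
      ((2 * Real.pi * x : ℝ) ^ (-w) * besselEntire (-w) (4 * Real.pi ^ 2 * ξ * x) -
        (2 * Real.pi * |ξ| : ℝ) ^ w * besselEntire w (4 * Real.pi ^ 2 * ξ * x)) := by
  have hI : ∀ σ : ℝ, σ ≠ 0 → Integrable fun x : ℝ => G x *
        ((-(2 * Real.pi * I * σ * x)) ^ (-w) *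
            besselEntire (-w) (2 * Real.pi * I * σ * ξ * -(2 * Real.pi * I * σ * x)) -
          (2 * Real.pi * I * σ * ξ) ^ w *
            besselEntire w (2 * Real.pi * I * σ * ξ * -(2 * Real.pi * I * σ * x))) := by
    intro σ hσ
    have e1 := continuous_besselEntire (ν := -w) (by simp; linarith)
    have e2 := continuous_besselEntire (ν := w) (by linarith)
    have hcont : Continuous fun x : ℝ => G x *
        ((-(2 * Real.pi * I * σ * x)) ^ (-w) *
            besselEntire (-w) (2 * Real.pi * I * σ * ξ * -(2 * Real.pi * I * σ * x)) -
          (2 * Real.pi * I * σ * ξ) ^ w *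
            besselEntire w (2 * Real.pi * I * σ * ξ * -(2 * Real.pi * I * σ * x))) := by
      refine continuous_iff_continuousAt.2 fun x => ?_
      by_cases hx : x ∈ tsupport G
      · refine G.continuous.continuousAt.mul (ContinuousAt.sub (ContinuousAt.mul
          (ContinuousAt.cpow (by fun_prop) continuousAt_const (Or.inr ?_))
          (e1.comp (by fun_prop)).continuousAt)
          (continuousAt_const.mul (e2.comp (by fun_prop)).continuousAt))
        exact im_two_pi_I_mul_ne_zero hσ (hG0 hx).ne'
      · refine (continuousAt_const (y := (0 : ℂ))).congr ?_
        filter_upwards [(isClosed_tsupport G).isOpen_compl.mem_nhds hx] with y hy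
        rw [image_eq_zero_of_notMem_tsupport hy, zero_mul]
    exact hcont.integrable_of_hasCompactSupport hGc.mul_right
  have m1 := mellin_fourier_mul_exp G.continuous hGc hG0 one_ne_zero hξ hw0 hw1
    (fourierInv_eq_integral G) (mellinConvergent_schwartz _ hw0)
  have m2 := mellin_fourier_mul_exp G.continuous hGc hG0 (neg_ne_zero.2 one_ne_zero) hξ hw0 hw1
    (fourier_eq_integral G) (mellinConvergent_schwartz _ hw0)
  rw [dualTransform, twistedMellinExt_eq _ hξ hw0, twistedMellinExt_eq _ (neg_ne_zero.2 hξ) hw0,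
    twistedMellin, twistedMellin]
  have r1 : (fun u : ℝ => (𝓕⁻ G : 𝓢(ℝ, ℂ)) u * cexp (-(2 * Real.pi * I * ξ) / u)) =
      fun u : ℝ => (𝓕⁻ G : 𝓢(ℝ, ℂ)) u * cexp (-(2 * Real.pi * I * (1 : ℝ) * ξ) / u) := by
    simp
  have r2 : (fun u : ℝ => (𝓕 G : 𝓢(ℝ, ℂ)) u * cexp (-(2 * Real.pi * I * (-ξ : ℝ)) / u)) =
      fun u : ℝ => (𝓕 G : 𝓢(ℝ, ℂ)) u * cexp (-(2 * Real.pi * I * (-1 : ℝ) * ξ) / u) := by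
    simp
  rw [r1, r2, m1, m2, ← mul_add,
    ← integral_add (hI 1 one_ne_zero) (hI (-1) (neg_ne_zero.2 one_ne_zero)),
    show kernelFactor w = Real.pi / Complex.sin (Real.pi * w) *
      (2 * Complex.cos (Real.pi * w / 2)) by rw [kernelFactor]; ring,
    mul_assoc (Real.pi / Complex.sin (Real.pi * w) : ℂ),
    ← integral_const_mul (2 * Complex.cos (Real.pi * w / 2))]
  congr 1
  refine integral_congr_ae (Eventually.of_forall fun x => ?_)
  rcases le_or_gt x 0 with hx | hx
  · simp [eq_zero_of_nonpos hG0 hx]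
  have hz : ∀ σ : ℝ, σ ^ 2 = 1 → 2 * Real.pi * I * σ * ξ * -(2 * Real.pi * I * σ * x) =
      4 * Real.pi ^ 2 * ξ * x := by
    intro σ hσ
    have hσ' : (σ : ℂ) ^ 2 = 1 := by exact_mod_cast hσ
    linear_combination (-4 * Real.pi ^ 2 * σ ^ 2 * ξ * x : ℂ) * I_sq +
      (4 * Real.pi ^ 2 * ξ * x : ℂ) * hσ'
  have h1 := cpow_add_cpow_neg hx (-w)
  rw [show (Real.pi * -w / 2 : ℂ) = -(Real.pi * w / 2) by ring, Complex.cos_neg] at h1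
  have h2 := cpow_add_cpow_neg_abs hξ w
  simp only [hz 1 (by norm_num), hz (-1) (by norm_num)]
  linear_combination (G x * besselEntire (-w) (4 * Real.pi ^ 2 * ξ * x)) * h1 -
    (G x * besselEntire w (4 * Real.pi ^ 2 * ξ * x)) * h2

/-- The Bessel integral representation of the dual transform on the line `Re w = 0`, as a limit
from the right. -/
theorem dualTransform_eq {G : 𝓢(ℝ, ℂ)} (hGc : HasCompactSupport G) (hG0 : tsupport G ⊆ Ioi 0)
    {ξ : ℝ} (hξ : ξ ≠ 0) {w : ℂ} (hw : w.re = 0) (hw0 : w ≠ 0) :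
    dualTransform (𝓕⁻ G) (𝓕 G) w ξ = kernelFactor w * ∫ x, G x *
      ((2 * Real.pi * x : ℝ) ^ (-w) * besselEntire (-w) (4 * Real.pi ^ 2 * ξ * x) -
        (2 * Real.pi * |ξ| : ℝ) ^ w * besselEntire w (4 * Real.pi ^ 2 * ξ * x)) := by
  have hsin : Complex.sin (Real.pi * w) ≠ 0 := by
    rw [Complex.sin_ne_zero_iff]
    intro k hk
    have hwk : w = (k : ℝ) := by
      rw [mul_comm] at hk
      exact mul_right_cancel₀ (b := (Real.pi : ℂ)) (by exact_mod_cast Real.pi_ne_zero)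
        (by rw [hk, ofReal_intCast])
    rw [hwk, ofReal_re] at hw
    exact hw0 (by rw [hwk, hw, ofReal_zero])
  have hS : IsOpen {s : ℂ | |s.re| < 1} :=
    isOpen_lt (continuous_abs.comp continuous_re) continuous_const
  have hwS : w ∈ {s : ℂ | |s.re| < 1} := by simp [hw]
  have c1 : ContinuousAt (fun s => dualTransform (𝓕⁻ G) (𝓕 G) s ξ) w :=
    ((differentiableAt_twistedMellinExt _ _ (by simp [hw])).add
      (differentiableAt_twistedMellinExt _ _ (by simp [hw]))).continuousAt
  have c2 : ContinuousAt kernelFactor w := by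
    refine ContinuousAt.div (by fun_prop) (by fun_prop) hsin
  have c3 : ContinuousAt (fun s : ℂ => ∫ x, G x *
      ((2 * Real.pi * x : ℝ) ^ (-s) * besselEntire (-s) (4 * Real.pi ^ 2 * ξ * x) -
        (2 * Real.pi * |ξ| : ℝ) ^ s * besselEntire s (4 * Real.pi ^ 2 * ξ * x))) w := by
    refine (continuousOn_integral_mul_of_hasCompactSupport G.continuous hGc
      (S := {s : ℂ | |s.re| < 1}) fun s hs x hx => ?_).continuousAt (hS.mem_nhds hwS)
    refine ContinuousAt.continuousWithinAt ?_
    have hs' := abs_lt.1 (show |s.re| < 1 from hs)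
    have hx : 0 < x := hG0 hx
    have hB : ∀ p : ℂ × ℂ, -1 < p.1.re →
        ContinuousAt (fun p : ℂ × ℂ => besselEntire p.1 p.2) p := fun p hp =>
      continuousOn_besselEntire.continuousAt
        ((isOpen_lt continuous_const (continuous_re.comp continuous_fst)).mem_nhds hp)
    refine ContinuousAt.sub (ContinuousAt.mul ?_ ?_) (ContinuousAt.mul ?_ ?_)
    · refine ContinuousAt.cpow (by fun_prop) (by fun_prop) (Or.inl ?_)
      rw [ofReal_re]; positivity
    · exact (hB (-s, 4 * Real.pi ^ 2 * ξ * x) (by simp; linarith)).comp'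
        (f := fun q : ℂ × ℝ => ((-q.1, 4 * Real.pi ^ 2 * ξ * q.2) : ℂ × ℂ)) (x := (s, x))
        (by fun_prop)
    · refine ContinuousAt.cpow (by fun_prop) (by fun_prop) (Or.inl ?_)
      rw [ofReal_re]; positivity
    · exact (hB (s, 4 * Real.pi ^ 2 * ξ * x) (by simp; linarith)).comp'
        (f := fun q : ℂ × ℝ => ((q.1, 4 * Real.pi ^ 2 * ξ * q.2) : ℂ × ℂ)) (x := (s, x))
        (by fun_prop)
  have hlim : Tendsto (fun δ : ℝ => w + δ) (𝓝[>] 0) (𝓝 w) := by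
    have : Continuous fun δ : ℝ => w + δ := by fun_prop
    simpa using (this.tendsto 0).mono_left nhdsWithin_le_nhds
  refine tendsto_nhds_unique (c1.tendsto.comp hlim)
    (((c2.mul c3).tendsto.comp hlim).congr' ?_)
  filter_upwards [Ioo_mem_nhdsGT (one_pos (α := ℝ))] with δ hδ
  exact (dualTransform_eq_of_re_pos hGc hG0 hξ (by simpa [hw] using hδ.1)
    (by simpa [hw] using hδ.2)).symm

/-! ### Bessel functions and the kernels -/

lemma besselI_eq (ν : ℂ) {x : ℝ} (hx : 0 < x) :
    besselI ν x = ((x / 2 : ℝ) : ℂ) ^ ν * besselEntire ν ((x / 2 : ℝ) ^ 2) := by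
  have h0 : ((x / 2 : ℝ) : ℂ) ≠ 0 := by exact_mod_cast (half_pos hx).ne'
  rw [besselI, besselEntire, ← tsum_mul_left]
  refine tsum_congr fun m => ?_
  rw [cpow_add _ _ h0, cpow_ofNat_mul, cpow_natCast, ← pow_mul, ← pow_mul]
  ring

lemma besselJ_eq (ν : ℂ) {x : ℝ} (hx : 0 < x) :
    besselJ ν x = ((x / 2 : ℝ) : ℂ) ^ ν * besselEntire ν (-(x / 2 : ℝ) ^ 2) := by
  have h0 : ((x / 2 : ℝ) : ℂ) ≠ 0 := by exact_mod_cast (half_pos hx).ne'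
  rw [besselJ, besselEntire, ← tsum_mul_left]
  refine tsum_congr fun m => ?_
  rw [cpow_add _ _ h0, cpow_ofNat_mul, cpow_natCast, ← pow_mul,
    neg_pow (((x / 2 : ℝ) : ℂ) ^ 2), ← pow_mul]
  ring

lemma two_I_mul_ne_intCast {r : ℝ} (hr : r ≠ 0) (k : ℤ) : 2 * I * r ≠ k := by
  intro h
  have := congrArg im h
  simp at this
  exact hr this

lemma cos_two_I_mul (r : ℝ) :
    Complex.cos (Real.pi * (2 * I * r) / 2) = Real.cosh (Real.pi * r) := by
  rw [show (Real.pi * (2 * I * r) / 2 : ℂ) = (Real.pi * r : ℝ) * I by push_cast; ring,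
    Complex.cos_mul_I, ofReal_cosh]

lemma kernelMinus_eq {r : ℝ} (hr : r ≠ 0) (x : ℝ) :
    kernelMinus r x = kernelFactor (2 * I * r) *
      (besselI (-(2 * I * r)) x - besselI (2 * I * r) x) := by
  rw [kernelMinus, besselK, if_neg (fun ⟨k, hk⟩ => two_I_mul_ne_intCast hr k hk), besselKQuot,
    kernelFactor, cos_two_I_mul]
  ring

lemma kernelPlus_eq {r : ℝ} (hr : r ≠ 0) (x : ℝ) :
    kernelPlus r x = kernelFactor (2 * I * r) *
      (besselJ (-(2 * I * r)) x - besselJ (2 * I * r) x) := by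
  have hcosh : (Real.cosh (Real.pi * r) : ℂ) ≠ 0 := by
    exact_mod_cast (Real.cosh_pos _).ne'
  have hcos : Complex.cos (Real.pi * (2 * I * r)) = 2 * (Real.cosh (Real.pi * r) : ℂ) ^ 2 - 1 := by
    rw [← cos_two_I_mul, ← Complex.cos_two_mul]
    ring_nf
  have hneg : ¬ ∃ k : ℤ, -(2 * I * r) = k := fun ⟨k, hk⟩ =>
    two_I_mul_ne_intCast hr (-k) (by push_cast; rw [← hk, neg_neg])
  rw [kernelPlus, besselY, besselY, if_neg (fun ⟨k, hk⟩ => two_I_mul_ne_intCast hr k hk),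
    if_neg hneg, besselYQuot, besselYQuot, kernelFactor, cos_two_I_mul, neg_neg, mul_neg,
    Complex.cos_neg, Complex.sin_neg, hcos]
  field_simp
  ring

lemma ofReal_cpow_eq_exp {y : ℝ} (hy : 0 < y) (s : ℂ) : (y : ℂ) ^ s = cexp (Real.log y * s) := by
  rw [cpow_def_of_ne_zero (by exact_mod_cast hy.ne'), ofReal_log hy.le]

/-- Homogeneity in `y = 2π√(ξx)`: both powers in the kernel share the factor `(ξ/x)^{w/2}`. -/
lemma cpow_kernel_eq {ξ x y : ℝ} (hξ : 0 < ξ) (hx : 0 < x) (hy : 0 < y)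
    (h : y ^ 2 = (2 * Real.pi) ^ 2 * (ξ * x)) (w : ℂ) :
    (x : ℂ) ^ (w / 2) * ((2 * Real.pi * x : ℝ) : ℂ) ^ (-w) =
      (ξ : ℂ) ^ (w / 2) * (y : ℂ) ^ (-w) ∧
    (x : ℂ) ^ (w / 2) * ((2 * Real.pi * ξ : ℝ) : ℂ) ^ w = (ξ : ℂ) ^ (w / 2) * (y : ℂ) ^ w := by
  have hπ : (0 : ℝ) < 2 * Real.pi := by positivity
  have hlog : 2 * Real.log y = 2 * Real.log (2 * Real.pi) + (Real.log ξ + Real.log x) := by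
    have := congrArg Real.log h
    rwa [Real.log_mul (by positivity) (by positivity), Real.log_mul hξ.ne' hx.ne', Real.log_pow,
      Real.log_pow] at this
  have hlog' : (2 * Real.log y : ℂ) = 2 * Real.log (2 * Real.pi) + (Real.log ξ + Real.log x) := by
    exact_mod_cast hlog
  constructor
  · rw [ofReal_cpow_eq_exp hx, ofReal_cpow_eq_exp hξ, ofReal_cpow_eq_exp hy,
      ofReal_cpow_eq_exp (by positivity), ← Complex.exp_add, ← Complex.exp_add,
      Real.log_mul hπ.ne' hx.ne', ofReal_add]
    congr 1
    linear_combination (w / 2) * hlog'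
  · rw [ofReal_cpow_eq_exp hx, ofReal_cpow_eq_exp hξ, ofReal_cpow_eq_exp hy,
      ofReal_cpow_eq_exp (by positivity), ← Complex.exp_add, ← Complex.exp_add,
      Real.log_mul hπ.ne' hξ.ne', ofReal_add]
    congr 1
    linear_combination (-w / 2) * hlog'

lemma kernelArg_half_sq {c n : ℕ} {x : ℝ} (hx : 0 ≤ x) :
    (4 * Real.pi * √(n * x) / c / 2) ^ 2 = (2 * Real.pi) ^ 2 * (n / (c : ℝ) ^ 2 * x) := by
  have := Real.sq_sqrt (show 0 ≤ n * x by positivity)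
  linear_combination (4 * Real.pi ^ 2 / (c : ℝ) ^ 2) * this

section Hankel

variable {G : 𝓢(ℝ, ℂ)} {F : ℝ → ℂ} {r : ℝ} {c n : ℕ}

/-- At the frequency `n/c²` the dual transform of `G(x) = x^{ir} F(x)` is the transform of `F` with
the kernel `J_r^-`. -/
lemma dualTransform_eq_hankelTransform_kernelMinus (hGc : HasCompactSupport G)
    (hG0 : tsupport G ⊆ Ioi 0) (hr : r ≠ 0) (hc : 0 < c) (hn : 0 < n)
    (hGF : ∀ x, 0 < x → G x = (x : ℂ) ^ (I * r) * F x) :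
    dualTransform (𝓕⁻ G) (𝓕 G) (2 * I * r) (1 * (n / (c : ℝ) ^ 2)) =
      ((n / (c : ℝ) ^ 2 : ℝ) : ℂ) ^ (I * r) * hankelTransform (kernelMinus r) F c n := by
  have hξ : 0 < n / (c : ℝ) ^ 2 := by positivity
  rw [one_mul, dualTransform_eq hGc hG0 hξ.ne' (by simp) (by simpa using hr), abs_of_pos hξ,
    integral_eq_setIntegral_Ioi hG0, hankelTransform, ← integral_const_mul, ← integral_const_mul]
  refine setIntegral_congr_fun measurableSet_Ioi fun x (hx : 0 < x) => ?_
  have hX : 0 < 4 * Real.pi * √(n * x) / c := by positivity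
  have hsq := kernelArg_half_sq (c := c) (n := n) hx.le
  obtain ⟨h1, h2⟩ := cpow_kernel_eq hξ hx (half_pos hX) hsq (2 * I * r)
  rw [show 2 * I * r / 2 = I * r by ring] at h1 h2
  have hz : (4 * Real.pi ^ 2 * (n / (c : ℝ) ^ 2 : ℝ) * x : ℂ) =
      ((4 * Real.pi * √(n * x) / c / 2 : ℝ) : ℂ) ^ 2 := by
    rw [← ofReal_pow (4 * Real.pi * √(n * x) / c / 2), hsq]; push_cast; ring
  simp only [kernelMinus_eq hr, besselI_eq _ hX, hGF x hx, hz]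
  linear_combination (kernelFactor (2 * I * r) * F x * besselEntire (-(2 * I * r))
      ((4 * Real.pi * √(n * x) / c / 2 : ℝ) ^ 2)) * h1 -
    (kernelFactor (2 * I * r) * F x * besselEntire (2 * I * r)
      ((4 * Real.pi * √(n * x) / c / 2 : ℝ) ^ 2)) * h2

/-- At the frequency `-n/c²` the dual transform of `G(x) = x^{ir} F(x)` is the transform of `F` with
the kernel `J_r^+`. -/
lemma dualTransform_eq_hankelTransform_kernelPlus (hGc : HasCompactSupport G)
    (hG0 : tsupport G ⊆ Ioi 0) (hr : r ≠ 0) (hc : 0 < c) (hn : 0 < n)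
    (hGF : ∀ x, 0 < x → G x = (x : ℂ) ^ (I * r) * F x) :
    dualTransform (𝓕⁻ G) (𝓕 G) (2 * I * r) (-1 * (n / (c : ℝ) ^ 2)) =
      ((n / (c : ℝ) ^ 2 : ℝ) : ℂ) ^ (I * r) * hankelTransform (kernelPlus r) F c n := by
  have hξ : 0 < n / (c : ℝ) ^ 2 := by positivity
  rw [neg_one_mul, dualTransform_eq hGc hG0 (neg_ne_zero.2 hξ.ne') (by simp) (by simpa using hr),
    abs_neg, abs_of_pos hξ,
    integral_eq_setIntegral_Ioi hG0, hankelTransform, ← integral_const_mul, ← integral_const_mul]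
  refine setIntegral_congr_fun measurableSet_Ioi fun x (hx : 0 < x) => ?_
  have hX : 0 < 4 * Real.pi * √(n * x) / c := by positivity
  have hsq := kernelArg_half_sq (c := c) (n := n) hx.le
  obtain ⟨h1, h2⟩ := cpow_kernel_eq hξ hx (half_pos hX) hsq (2 * I * r)
  rw [show 2 * I * r / 2 = I * r by ring] at h1 h2
  have hz : (4 * Real.pi ^ 2 * (-(n / (c : ℝ) ^ 2) : ℝ) * x : ℂ) =
      -((4 * Real.pi * √(n * x) / c / 2 : ℝ) : ℂ) ^ 2 := by
    rw [← ofReal_pow (4 * Real.pi * √(n * x) / c / 2), hsq]; push_cast; ring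
  simp only [kernelPlus_eq hr, besselJ_eq _ hX, hGF x hx, hz]
  linear_combination (kernelFactor (2 * I * r) * F x * besselEntire (-(2 * I * r))
      (-(4 * Real.pi * √(n * x) / c / 2 : ℝ) ^ 2)) * h1 -
    (kernelFactor (2 * I * r) * F x * besselEntire (2 * I * r)
      (-(4 * Real.pi * √(n * x) / c / 2 : ℝ) ^ 2)) * h2

end Hankel

/-! ### Sums over divisors and polar terms -/

lemma heckeEigenvalue_eq (r : ℝ) {n : ℕ} (hn : 0 < n) :
    heckeEigenvalue r n = (n : ℂ) ^ (I * r) *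
      ∑ q ∈ n.divisorsAntidiagonal, (q.1 : ℂ) ^ (-(2 * I * r)) := by
  rw [heckeEigenvalue, Nat.sum_divisorsAntidiagonal' (n := n)
    fun i j => (((i : ℝ) / j : ℝ) : ℂ) ^ (I * r), Nat.sum_divisorsAntidiagonal (n := n)
    fun i _ => (i : ℂ) ^ (-(2 * I * r)), Finset.mul_sum]
  refine Finset.sum_congr rfl fun i hi => ?_
  have hi0 : 0 < i := Nat.pos_of_mem_divisors hi
  have hR : (0 : ℝ) < i := by exact_mod_cast hi0
  have hnR : (0 : ℝ) < n := by exact_mod_cast hn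
  rw [Nat.cast_div (Nat.dvd_of_mem_divisors hi) hR.ne', ← ofReal_natCast n, ← ofReal_natCast i,
    ofReal_cpow_eq_exp (by positivity), ofReal_cpow_eq_exp hnR, ofReal_cpow_eq_exp hR,
    ← Complex.exp_add, Real.log_div (by positivity) hR.ne', Real.log_div hnR.ne' hR.ne']
  congr 1
  push_cast
  ring

/-- Grouping a sum over pairs of positive integers by their product. -/
lemma hasSum_divisorsAntidiagonal {g : ℕ → ℂ} {s : ℂ}
    (hf : Summable fun p : ℕ+ × ℕ+ => ((p.1 : ℕ) : ℂ) ^ s * g ((p.1 * p.2 : ℕ+) : ℕ)) :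
    HasSum (fun n : ℕ+ => (∑ q ∈ (n : ℕ).divisorsAntidiagonal, (q.1 : ℂ) ^ s) * g n)
      (∑' p : ℕ+ × ℕ+, ((p.1 : ℕ) : ℂ) ^ s * g ((p.1 * p.2 : ℕ+) : ℕ)) := by
  have h := (sigmaAntidiagonalEquivProd.hasSum_iff.2 hf.hasSum).sigma fun n => hasSum_fintype _
  refine h.congr_fun fun n => ?_
  rw [Finset.sum_mul, ← Finset.sum_coe_sort]
  refine Finset.sum_congr rfl fun q _ => ?_
  have hq := (Nat.mem_divisorsAntidiagonal.1 q.2).1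
  simp [sigmaAntidiagonalEquivProd, divisorsAntidiagonalFactors, hq]

lemma natCast_cpow_mul_div_sq_cpow {c n : ℕ} (hc : 0 < c) (hn : 0 < n) (r : ℝ) :
    (c : ℂ) ^ (2 * I * r) * ((n / (c : ℝ) ^ 2 : ℝ) : ℂ) ^ (I * r) = (n : ℂ) ^ (I * r) := by
  have hcR : (0 : ℝ) < c := by exact_mod_cast hc
  have hnR : (0 : ℝ) < n := by exact_mod_cast hn
  have hξ : 0 < n / (c : ℝ) ^ 2 := by positivity
  rw [← ofReal_natCast n, ← ofReal_natCast c, ofReal_cpow_eq_exp hξ,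
    ofReal_cpow_eq_exp hnR, ofReal_cpow_eq_exp hcR, ← Complex.exp_add,
    Real.log_div hnR.ne' (by positivity), Real.log_pow]
  congr 1
  push_cast
  ring

section

variable {G : 𝓢(ℝ, ℂ)} {F : ℝ → ℂ} {r : ℝ} {c : ℕ}

lemma hasSum_dualTermMinus (hGc : HasCompactSupport G)
    (hG0 : tsupport G ⊆ Ioi 0) (hr : r ≠ 0) (hc : 0 < c) (b : ℤ)
    (hGF : ∀ x, 0 < x → G x = (x : ℂ) ^ (I * r) * F x) :
    HasSum (fun n : ℕ+ => dualTermMinus r F c b n)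
      ((c : ℂ) ^ (2 * I * r) * ∑' p, dualPart (𝓕⁻ G) (𝓕 G) b c 1 (2 * I * r) p) := by
  have h := (hasSum_divisorsAntidiagonal (s := -(2 * I * r)) (g := fun n =>
    dualTransform (𝓕⁻ G) (𝓕 G) (2 * I * r) (1 * (n / (c : ℝ) ^ 2)) * e (1 * (n * (b : ℝ) / c)))
    (summable_dualPart (𝓕⁻ G) (𝓕 G) b hc (ε := 1) (w := 2 * I * r) (by simp)
      (by simp; norm_num))).mul_left ((c : ℂ) ^ (2 * I * r))
  refine h.congr_fun fun n => ?_
  have hd := dualTransform_eq_hankelTransform_kernelMinus hGc hG0 hr hc n.pos hGF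
  rw [hd, dualTermMinus, heckeEigenvalue_eq r n.pos, ← natCast_cpow_mul_div_sq_cpow hc n.pos r]
  simp only [one_mul]
  ring

lemma hasSum_dualTermPlus (hGc : HasCompactSupport G)
    (hG0 : tsupport G ⊆ Ioi 0) (hr : r ≠ 0) (hc : 0 < c) (b : ℤ)
    (hGF : ∀ x, 0 < x → G x = (x : ℂ) ^ (I * r) * F x) :
    HasSum (fun n : ℕ+ => dualTermPlus r F c b n)
      ((c : ℂ) ^ (2 * I * r) * ∑' p, dualPart (𝓕⁻ G) (𝓕 G) b c (-1) (2 * I * r) p) := by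
  have h := (hasSum_divisorsAntidiagonal (s := -(2 * I * r)) (g := fun n =>
    dualTransform (𝓕⁻ G) (𝓕 G) (2 * I * r) (-1 * (n / (c : ℝ) ^ 2)) * e (-1 * (n * (b : ℝ) / c)))
    (summable_dualPart (𝓕⁻ G) (𝓕 G) b hc (ε := -1) (w := 2 * I * r) (by simp)
      (by simp; norm_num))).mul_left ((c : ℂ) ^ (2 * I * r))
  refine h.congr_fun fun n => ?_
  have hd := dualTransform_eq_hankelTransform_kernelPlus hGc hG0 hr hc n.pos hGF
  rw [hd, dualTermPlus, heckeEigenvalue_eq r n.pos, ← natCast_cpow_mul_div_sq_cpow hc n.pos r]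
  simp only [neg_one_mul]
  ring

lemma tsum_eq_tsum_heckeEigenvalue {B : ℝ} (hB : ∀ x, G x ≠ 0 → x ≤ B) (a : ℕ)
    (hGF : ∀ x, 0 < x → G x = (x : ℂ) ^ (I * r) * F x) :
    ∑' p : ℕ+ × ℕ+, ((p.1 : ℕ) : ℂ) ^ (-(2 * I * r)) *
        (G (((p.1 * p.2 : ℕ+) : ℕ) : ℝ) * e (((p.1 * p.2 : ℕ+) : ℕ) * ((a : ℝ) / c))) =
      ∑' n : ℕ+, heckeEigenvalue r n * e ((n : ℝ) * ((a : ℝ) / c)) * F (n : ℝ) := by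
  have hs : Summable fun p : ℕ+ × ℕ+ => ((p.1 : ℕ) : ℂ) ^ (-(2 * I * r)) *
      (G (((p.1 * p.2 : ℕ+) : ℕ) : ℝ) * e (((p.1 * p.2 : ℕ+) : ℕ) * ((a : ℝ) / c))) :=
    summable_of_hasFiniteSupport ((finite_setOf_mul_ne_zero hB).subset fun p hp h0 => hp (by
      simp only [h0, zero_mul, mul_zero]))
  rw [← (hasSum_divisorsAntidiagonal (g := fun n => G n * e (n * ((a : ℝ) / c))) hs).tsum_eq]
  refine tsum_congr fun n => ?_
  simp only [heckeEigenvalue_eq r n.pos, hGF n (by exact_mod_cast n.pos), ofReal_natCast]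
  ring

lemma polarTerm_eq (hG0 : tsupport G ⊆ Ioi 0) (hc : 0 < c) (t : ℝ)
    (hGF : ∀ x, 0 < x → G x = (x : ℂ) ^ (I * r) * F x) :
    polarTerm t F c = (c : ℂ) ^ (-(2 * I * t)) *
      (riemannZeta (1 + 2 * I * t) * ∫ x, G x * (x : ℂ) ^ (I * t - I * r)) := by
  have hcR : (0 : ℝ) < c := by exact_mod_cast hc
  rw [polarTerm, mul_left_comm, integral_eq_setIntegral_Ioi hG0,
    ← integral_const_mul ((c : ℂ) ^ (-(2 * I * t)))]
  congr 1
  refine setIntegral_congr_fun measurableSet_Ioi fun x (hx : 0 < x) => ?_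
  have hq : 0 < x / (c : ℝ) ^ 2 := by positivity
  have key : ((x / (c : ℝ) ^ 2 : ℝ) : ℂ) ^ (I * t) =
      (c : ℂ) ^ (-(2 * I * t)) * ((x : ℂ) ^ (I * r) * (x : ℂ) ^ (I * t - I * r)) := by
    rw [← ofReal_natCast c, ofReal_cpow_eq_exp hq, ofReal_cpow_eq_exp hx, ofReal_cpow_eq_exp hx,
      ofReal_cpow_eq_exp hcR, ← Complex.exp_add, ← Complex.exp_add,
      Real.log_div hx.ne' (by positivity), Real.log_pow]
    congr 1
    push_cast
    ring
  rw [hGF x hx, key]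
  ring

end

/-- Multiplying by `x^s`, cut off to `x > 0`, keeps functions supported in `(0, ∞)` smooth. -/
lemma contDiff_cpow_mul {F : ℝ → ℂ} (hF : ContDiff ℝ ∞ F) (hFpos : tsupport F ⊆ Ioi 0) (s : ℂ) :
    ContDiff ℝ ∞ fun x : ℝ => cexp (Real.log x * s) * F x := by
  refine contDiff_iff_contDiffAt.2 fun x => ?_
  by_cases hx : x ∈ tsupport F
  · have h1 : ContDiffAt ℝ ∞ Real.log x := Real.contDiffAt_log.2 (hFpos hx).ne'
    exact (((ofRealCLM.contDiff.contDiffAt.comp x h1).mul contDiffAt_const).cexp).mul hF.contDiffAt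
  · refine (contDiffAt_const (c := (0 : ℂ))).congr_of_eventuallyEq ?_
    filter_upwards [(isClosed_tsupport F).isOpen_compl.mem_nhds hx] with y hy
    rw [image_eq_zero_of_notMem_tsupport hy, mul_zero]

end Voronoi

theorem proposition2
    (r : ℝ) (hr : r ≠ 0)
    (a c : ℕ) (ha : 0 < a) (hc : 0 < c) (hac : Nat.Coprime a c)
    (abar : ℤ) (habar : (a : ℤ) * abar ≡ 1 [ZMOD (c : ℤ)])
    (F : ℝ → ℂ) (hF : ContDiff ℝ ∞ F) (hFc : HasCompactSupport F)
    (hFpos : tsupport F ⊆ Set.Ioi (0 : ℝ)) :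
    Summable (fun n : ℕ+ => Voronoi.dualTermPlus r F c abar n) ∧
    Summable (fun n : ℕ+ => Voronoi.dualTermMinus r F c abar n) ∧
    (c : ℂ) * ∑' n : ℕ+, Voronoi.heckeEigenvalue r n *
        Voronoi.e ((n : ℝ) * ((a : ℝ) / (c : ℝ))) * F (n : ℝ) =
      ∑' n : ℕ+, (Voronoi.dualTermPlus r F c abar n + Voronoi.dualTermMinus r F c abar n) +
        (Voronoi.polarTerm r F c + Voronoi.polarTerm (-r) F c) := by
  have hsm := Voronoi.contDiff_cpow_mul hF hFpos (Complex.I * r)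
  have hcs : HasCompactSupport fun x : ℝ => Complex.exp (Real.log x * (Complex.I * r)) * F x :=
    hFc.mul_left
  set G : SchwartzMap ℝ ℂ := hcs.toSchwartzMap hsm with hG
  have hGx : ∀ x, G x = Complex.exp (Real.log x * (Complex.I * r)) * F x := fun x => rfl
  have hGc : HasCompactSupport G := hcs
  have hG0 : tsupport G ⊆ Set.Ioi 0 := (tsupport_mul_subset_right).trans hFpos
  have hGF : ∀ x : ℝ, 0 < x → G x = (x : ℂ) ^ (Complex.I * r) * F x := fun x hx => by
    rw [hGx, Voronoi.ofReal_cpow_eq_exp hx]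
  have hp := Voronoi.hasSum_dualTermPlus hGc hG0 hr hc abar hGF
  have hm := Voronoi.hasSum_dualTermMinus hGc hG0 hr hc abar hGF
  obtain ⟨A, B, hA, hAB⟩ := Voronoi.exists_support_subset_Icc hGc hG0
  have hB : ∀ x, G x ≠ 0 → x ≤ B := fun x hx => (hAB (subset_tsupport _ hx)).2
  have hcc : (c : ℂ) ≠ 0 := by exact_mod_cast hc.ne'
  refine ⟨hp.summable, hm.summable, ?_⟩
  rw [← Voronoi.tsum_eq_tsum_heckeEigenvalue hB a hGF, Voronoi.tsum_eq_dual hGc hG0 hr hc habar,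
    hp.summable.tsum_add hm.summable, hp.tsum_eq, hm.tsum_eq, Voronoi.polarTerm_eq hG0 hc r hGF,
    Voronoi.polarTerm_eq hG0 hc (-r) hGF]
  have e1 : (c : ℂ) * (c : ℂ) ^ (-1 - 2 * Complex.I * r) = (c : ℂ) ^ (-(2 * Complex.I * r)) := by
    rw [show -(2 * Complex.I * r) = 1 + (-1 - 2 * Complex.I * r) by ring,
      Complex.cpow_add _ _ hcc, Complex.cpow_one]
  have e2 : (c : ℂ) * (c : ℂ) ^ (2 * Complex.I * r - 1) = (c : ℂ) ^ (2 * Complex.I * r) := by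
    rw [Complex.cpow_sub _ _ hcc, Complex.cpow_one, mul_div_cancel₀ _ hcc]
  have e3 : Complex.I * ((-r : ℝ) : ℂ) - Complex.I * r = -(2 * Complex.I * r) := by push_cast; ring
  have e4 : -(2 * Complex.I * ((-r : ℝ) : ℂ)) = 2 * Complex.I * r := by push_cast; ring
  have e5 : 1 + 2 * Complex.I * ((-r : ℝ) : ℂ) = 1 - 2 * Complex.I * r := by push_cast; ring
  rw [e3, e4, e5, mul_add, ← mul_assoc (c : ℂ), ← mul_assoc (c : ℂ), e1, e2]
  simp only [sub_self, Complex.cpow_zero, mul_one]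
  ring
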